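/- **Definitions.** A strict partition is a finite (possibly empty) sequence $\lambda=(\lambda_1>\lambda_2>\dots>\lambda_\ell>0)$ of integers. * The bar lengths in row $i$ of $\lambda$ are the elements of $\{\lambda_i+\lambda_j : j>i\}\cup\big(\{1,\dots,\lambda_i\}\setminus\{\lambda_i-\lambda_j : j>i\}\big)$, and $\lambda$ is an $\overline{s}$-core if $s$ is not a bar length in any row. * The shifted Young diagram $S(\lambda)$ has in row $i$ the boxes $(i,j)$, $i\le j\le i+\lambda_i-1$. The shifted hook length of the box $(i,j)$ is the number of boxes of $S(\lambda)$ that are $(i,j)$ itself, to its right in row $i$, below it in column $j$, or in row $j+1$. $\lambda$ is an $s$-CSYD ($s$-core shifted Young diagram) if no shifted hook length in $S(\lambda)$ is divisible by $s$. * The doubled distinct partition $\lambda\lambda$ is the partition whose Young diagram has $\ell$ diagonal boxes, the $i$th having arm length $\lambda_i$ and leg length $\lambda_i-1$. It is a doubled distinct $s$-core if none of its hook lengths is divisible by $s$. Let $\mathcal{BC}$, $\mathcal{CS}$ and $\mathcal{DD}$ be the sets of, respectively, the strict partitions that are $\overline{s}$-, $\overline{s+d}$- and $\overline{s+2d}$-cores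 at the same time, the $(s,s+d,s+2d)$-CSYDs (CSYDs for each of the three numbers), and the doubled distinct $(s,s+d,s+2d)$-cores (doubled distinct cores for each of the three numbers). For $n\in\mathbb Z$ and $k\ge 0$ let $\binom nk=n(n-1)\cdots(n-k+1)/k!$ (so $\binom{-1}{0}=1$), and for $a+b+c=n$ let $\binom{n}{a,b,c}=\frac{n!}{a!\,b!\,c!}$. **Theorem 1.2.** Let $s$ and $d$ be coprime positive integers. Then $\mathcal{BC}$, $\mathcal{CS}$ and $\mathcal{DD}$ are finite, and the following hold. (a) For odd $s$ and even $d$, $$|\mathcal{BC}|=|\mathcal{CS}|=|\mathcal{DD}|=\sum_{i=0}^{(s-1)/2}\binom{(s+d-3)/2}{\lfloor i/2 \rfloor}\binom{(s+d-1)/2-\lfloor i/2 \rfloor}{(s-1)/2-i}.$$ (b) For odd $s$ and odd $d$, $|\mathcal{BC}|=|\mathcal{CS}|$. This number is $1$ if $s=d=1$, and otherwise it is $$\sum_{i=0}^{(s-1)/2}\binom{(d-1)/2+i}{\lfloor i/2 \rfloor}\left( \binom{(s+d-2)/2}{(d-1)/2+i} + \binom{(s+d-4)/2}{(d-1)/2+i}\right).$$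 (c) For even $s$ and odd $d$, $$|\mathcal{BC}|=\sum_{i=0}^{s/2} \binom{(s+d-1)/2}{\lfloor i/2 \rfloor,\ \lfloor (d+i)/2\rfloor,\ s/2 -i},$$ $$|\mathcal{CS}|=\sum_{i=0}^{(s-2)/2}\binom{(s+d-3)/2}{\lfloor i/2 \rfloor}\binom{(s+d-3)/2-\lfloor i/2 \rfloor}{(s-2)/2-i}+\sum_{i=0}^{(s-2)/2}\binom{(s+d-5)/2}{\lfloor i/2 \rfloor}\binom{(s+d-1)/2-\lfloor i/2 \rfloor}{(s-2)/2-i}.$$ (d) For odd $d$ (and $s$ of either parity), $$|\mathcal{DD}|=\sum_{i=0}^{ \lfloor(s-1)/2\rfloor} \binom{\lfloor (s+d-2)/2\rfloor }{\lfloor i/2 \rfloor,\ \lfloor (d+i)/2\rfloor,\ \lfloor(s-1)/2\rfloor -i}.$$ -/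

import Mathlib

/-- A strict partition: a (possibly empty) strictly decreasing list of positive integers. -/
@[ext] structure StrictPartition where
  parts : List ℕ
  strict : parts.Pairwise (· > ·)
  pos : ∀ p ∈ parts, 0 < p

namespace StrictPartition

/-- The number `ℓ` of parts. -/
def length (lam : StrictPartition) : ℕ := lam.parts.length

/-- The part in row `i`, rows being numbered from `0`; it is `0` when `i ≥ ℓ`. -/
def part (lam : StrictPartition) (i : ℕ) : ℕ := lam.parts.getD i 0

/-- The set of bar lengths in row `i` (for `i < ℓ`):
`{λ_i + λ_j : i < j} ∪ ({1, …, λ_i} \ {λ_i - λ_j : i < j})`. -/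
def barLengths (lam : StrictPartition) (i : ℕ) : Set ℕ :=
  {h | ∃ j, i < j ∧ j < lam.length ∧ h = lam.part i + lam.part j} ∪
    (Set.Icc 1 (lam.part i) \
      {h | ∃ j, i < j ∧ j < lam.length ∧ h = lam.part i - lam.part j})

/-- `λ` is an `s`-bar-core: `s` is not a bar length in any row. -/
def IsBarCore (s : ℕ) (lam : StrictPartition) : Prop :=
  ∀ i < lam.length, s ∉ lam.barLengths i

/-- The shifted Young diagram `S(λ)`, with rows and columns numbered from `0`:
row `i` consists of the boxes in columns `i, …, i + λ_i - 1`. -/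
def shiftedDiagram (lam : StrictPartition) : Finset (ℕ × ℕ) :=
  (Finset.range lam.length).biUnion fun i =>
    (Finset.Ico i (i + lam.part i)).image fun j => (i, j)

/-- The shifted hook length of the box `(i, j)` of `S(λ)`: the number of boxes of `S(λ)`
weakly to its right in row `i`, strictly below it in column `j`, or in row `j + 1`. -/
def shiftedHookLength (lam : StrictPartition) (i j : ℕ) : ℕ :=
  (lam.shiftedDiagram.filter fun c =>
    (c.1 = i ∧ j ≤ c.2) ∨ (i < c.1 ∧ c.2 = j) ∨ c.1 = j + 1).card

/-- `S(λ)` is an `s`-core shifted Young diagram: no shifted hook length is divisible by `s`. -/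
def IsCSYD (s : ℕ) (lam : StrictPartition) : Prop :=
  ∀ c ∈ lam.shiftedDiagram, ¬ s ∣ lam.shiftedHookLength c.1 c.2

theorem mem_shiftedDiagram (lam : StrictPartition) (i j : ℕ) :
    (i, j) ∈ lam.shiftedDiagram ↔ i < lam.length ∧ i ≤ j ∧ j < i + lam.part i := by
  simp [shiftedDiagram]

theorem part_pos (lam : StrictPartition) {i : ℕ} (hi : i < lam.length) : 0 < lam.part i := by
  have h : i < lam.parts.length := hi
  simp only [part, List.getD_eq_getElem _ _ h]
  exact lam.pos _ (List.getElem_mem h)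

theorem part_lt (lam : StrictPartition) {i j : ℕ} (hij : i < j) (hj : j < lam.length) :
    lam.part j < lam.part i := by
  have h : j < lam.parts.length := hj
  simp only [part, List.getD_eq_getElem _ _ h, List.getD_eq_getElem _ _ (hij.trans h)]
  exact List.pairwise_iff_getElem.1 lam.strict i j (hij.trans h) h hij

theorem add_part_le (lam : StrictPartition) {i j : ℕ} (hij : i ≤ j) (hj : j < lam.length) :
    j + lam.part j ≤ i + lam.part i := by
  induction j, hij using Nat.le_induction with
  | base => exact le_rfl
  | succ k hk ih =>
    have h1 := ih (by omega)
    have h2 := lam.part_lt (Nat.lt_succ_self k) hj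
    simp only [Nat.succ_eq_add_one] at h2
    omega

/-- The set of boxes of the doubled distinct partition `λλ`, with rows and columns numbered
from `0`: the boxes of `S(λ)` are moved one column to the right, and below the diagonal `λ_i`
boxes are added to column `i`, in rows `i, …, i + λ_i - 1`. So the diagonal box `(i, i)`,
`i < ℓ`, has arm `λ_i` and leg `λ_i - 1`. -/
def doubledCells (lam : StrictPartition) : Finset (ℕ × ℕ) :=
  (lam.shiftedDiagram.image fun c => (c.1, c.2 + 1)) ∪
    (lam.shiftedDiagram.image fun c => (c.2, c.1))

theorem mem_doubledCells (lam : StrictPartition) (i j : ℕ) :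
    (i, j) ∈ lam.doubledCells ↔
      (i < j ∧ i < lam.length ∧ j ≤ i + lam.part i) ∨
        (j ≤ i ∧ j < lam.length ∧ i < j + lam.part j) := by
  simp only [doubledCells, Finset.mem_union, Finset.mem_image, Prod.exists, Prod.mk.injEq,
    mem_shiftedDiagram]
  constructor
  · rintro (⟨a, b, h, rfl, rfl⟩ | ⟨a, b, h, rfl, rfl⟩) <;> omega
  · rintro (h | h)
    · exact Or.inl ⟨i, j - 1, by omega, rfl, by omega⟩
    · exact Or.inr ⟨j, i, by omega, rfl, rfl⟩

/-- The doubled distinct partition `λλ`, as a Young diagram. -/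
def doubled (lam : StrictPartition) : YoungDiagram where
  cells := lam.doubledCells
  isLowerSet := by
    rintro ⟨i, j⟩ ⟨a, b⟩ hle hmem
    obtain ⟨hai, hbj⟩ : a ≤ i ∧ b ≤ j := hle
    simp only [Finset.mem_coe, mem_doubledCells] at hmem ⊢
    rcases hmem with ⟨h1, h2, h3⟩ | ⟨h1, h2, h3⟩
    · have hp := lam.part_pos h2
      have ha := lam.add_part_le hai h2
      rcases lt_or_ge a b with h | h
      · exact Or.inl (by omega)
      · have hb := lam.add_part_le (h.trans hai) h2
        exact Or.inr (by omega)
    · have hp := lam.part_pos h2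
      have hb := lam.add_part_le hbj h2
      rcases lt_or_ge a b with h | h
      · have ha := lam.add_part_le (h.le.trans hbj) h2
        exact Or.inl (by omega)
      · exact Or.inr (by omega)

end StrictPartition

/-- The hook length of the box `(i, j)` of a Young diagram: the number of boxes weakly to its
right in row `i` or strictly below it in column `j`. -/
def YoungDiagram.hookLength (mu : YoungDiagram) (i j : ℕ) : ℕ :=
  (mu.cells.filter fun c => (c.1 = i ∧ j ≤ c.2) ∨ (i < c.1 ∧ c.2 = j)).card

/-- A partition is an `s`-core if none of its hook lengths is divisible by `s`. -/
def YoungDiagram.IsCore (s : ℕ) (mu : YoungDiagram) : Prop :=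
  ∀ c ∈ mu.cells, ¬ s ∣ mu.hookLength c.1 c.2

/-- The set of `(s₁, …, s_p)`-bar-cores. -/
def barCores (L : List ℕ) : Set StrictPartition :=
  {lam | ∀ s ∈ L, lam.IsBarCore s}

/-- The set of `(s₁, …, s_p)`-CSYDs, a shifted Young diagram `S(λ)` being given by `λ`. -/
def coreShiftedDiagrams (L : List ℕ) : Set StrictPartition :=
  {lam | ∀ s ∈ L, lam.IsCSYD s}

/-- The set of doubled distinct `(s₁, …, s_p)`-cores. -/
def doubledDistinctCores (L : List ℕ) : Set YoungDiagram :=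
  {mu | (∃ lam : StrictPartition, lam.doubled = mu) ∧ ∀ s ∈ L, mu.IsCore s}

/-- The trinomial coefficient `n! / (a! b! c!)`, for `a + b + c = n` (and `0` otherwise). -/
def trinomial (n a b c : ℕ) : ℕ :=
  if a + b + c = n then
    Nat.factorial n / (Nat.factorial a * Nat.factorial b * Nat.factorial c)
  else 0

/-!
A strict partition `λ` is encoded by its Maya diagram `M ⊆ ℤ`: the parts of `λ`, together with the
numbers `-y` for the positive integers `y` that are not parts. This is the set of row labels of the
doubled distinct partition `λλ`, and a hook length of `λλ` is a difference `x - y` of a row label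
`x ∈ M` and a column label `y ∉ M`. Hence `λλ` is an `s`-core if and only if `M - s ⊆ M`
(`isCore_doubled_iff`). Bar cores satisfy the same condition, except that `s / 2 ∈ M` is tolerated
(`isBarCore_iff`), and the CSYDs are the bar cores without the part `3 s / 2` (`isCSYD_iff`).

Put `n = s + d`, which is coprime to `d`, and write the integers as `d i + n j`. If `M - n ⊆ M`, then
`M` consists of the points on or below the graph of a function, the profile `h`. It satisfies
`h 0 = -1`, `h (i + n) = h i - d`, and `h (-i) = -1 - h i` for `i` not divisible by `n`, so it is
determined by its values on `0, …, n / 2`. Subtracting `s` moves `(i, j)` to `(i + 1, j - 1)` and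
subtracting `s + 2 d` moves it to `(i - 1, j - 1)`; so stability under both says that `h` has steps
`-1`, `0` or `1`. The doubled distinct cores thus become lattice paths of length `n / 2` that start
with `h 0 = -1` and `h 1 ∈ {-1, 0}` and whose end lies close to `-(1 + d) / 2`
(`encard_hasUnitSteps_sep`, `forall_abs_sub_le_one_iff`).

The tolerated parts only affect the last steps. For even `s` they allow the middle step of `h` to be
`2` or `-2` (`forall_exception_iff`), and the parts forbidden to CSYDs bound `h (n / 2 - 1)`. For odd
`s` and odd `d` the part `n / 2` can be inserted exactly when
`h (n / 2 - 1) = h (n / 2) = -(1 + d) / 2`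
(`encard_barCores_sep_half_mem`, `encard_barCores_of_odd_of_odd`), and the part `3 n / 2` never
occurs. In each case the count is a sum of numbers `walkCount N k` of walks with `N` steps
from `0` to `k`; summing over the number of steps `-1` and applying Pascal's rule gives the stated
sums (`walkCount_eq_sum`, `sum_choose_mul_choose`, `sum_choose_mul_choose_sub`).
-/

/-! ### Hook lengths and Maya diagrams -/

namespace YoungDiagram

theorem hookLength_eq (mu : YoungDiagram) {i j : ℕ} (h : (i, j) ∈ mu) :
    (mu.hookLength i j : ℤ) = (mu.rowLen i - i - 1 : ℤ) - (j - mu.colLen j) := by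
  have hj := mem_iff_lt_rowLen.1 h
  have hi := mem_iff_lt_colLen.1 h
  have hset : (mu.cells.filter fun c => (c.1 = i ∧ j ≤ c.2) ∨ (i < c.1 ∧ c.2 = j)) =
      (Finset.Ico j (mu.rowLen i)).image (fun b => (i, b)) ∪
        (Finset.Ioo i (mu.colLen j)).image (fun a => (a, j)) := by
    ext ⟨a, b⟩
    simp only [Finset.mem_filter, mem_cells, Finset.mem_union, Finset.mem_image, Finset.mem_Ico,
      Finset.mem_Ioo, Prod.mk.injEq]
    constructor
    · rintro ⟨hm, ⟨rfl, hb⟩ | ⟨ha, rfl⟩⟩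
      · exact Or.inl ⟨b, ⟨hb, mem_iff_lt_rowLen.1 hm⟩, rfl, rfl⟩
      · exact Or.inr ⟨a, ⟨ha, mem_iff_lt_colLen.1 hm⟩, rfl, rfl⟩
    · rintro (⟨b', ⟨h1, h2⟩, rfl, rfl⟩ | ⟨a', ⟨h1, h2⟩, rfl, rfl⟩)
      · exact ⟨mem_iff_lt_rowLen.2 h2, Or.inl ⟨rfl, h1⟩⟩
      · exact ⟨mem_iff_lt_colLen.2 h2, Or.inr ⟨h1, rfl⟩⟩
  have hdisj : Disjoint ((Finset.Ico j (mu.rowLen i)).image (fun b => (i, b)))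
      ((Finset.Ioo i (mu.colLen j)).image (fun a => (a, j))) := by
    rw [Finset.disjoint_left]
    rintro ⟨a, b⟩ h1 h2
    simp only [Finset.mem_image, Finset.mem_Ico, Finset.mem_Ioo, Prod.mk.injEq] at h1 h2
    omega
  rw [hookLength, hset, Finset.card_union_of_disjoint hdisj,
    Finset.card_image_of_injective _ (Prod.mk_right_injective i),
    Finset.card_image_of_injective _ (Prod.mk_left_injective j), Nat.card_Ico, Nat.card_Ioo]
  omega

/-- The numbers `rowLen i - i - 1` and `j - colLen j` label the vertical and the horizontal steps
of the boundary of `mu`. Every integer is the label of a step, and of only one by `row_ne_col`. -/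
theorem exists_row_or_col (mu : YoungDiagram) (v : ℤ) :
    (∃ i : ℕ, (mu.rowLen i - i - 1 : ℤ) = v) ∨ ∃ j : ℕ, (j - mu.colLen j : ℤ) = v := by
  have hex : ∃ i : ℕ, (mu.rowLen i : ℤ) - i ≤ v := by
    refine ⟨mu.rowLen 0 + v.natAbs, ?_⟩
    have := mu.rowLen_anti 0 (mu.rowLen 0 + v.natAbs) (Nat.zero_le _)
    omega
  classical
  obtain ⟨i, hi, hmin⟩ : ∃ i : ℕ, (mu.rowLen i : ℤ) - i ≤ v ∧
      ∀ k < i, ¬ (mu.rowLen k : ℤ) - k ≤ v :=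
    ⟨Nat.find hex, Nat.find_spec hex, fun k hk => Nat.find_min hex hk⟩
  obtain ⟨j, hj⟩ : ∃ j : ℕ, (j : ℤ) = v + i := ⟨(v + i).toNat, by omega⟩
  have hcol : ¬ i < mu.colLen j := by
    rw [← mem_iff_lt_colLen, mem_iff_lt_rowLen]
    omega
  rcases Nat.eq_zero_or_pos i with h0 | hpos
  · exact Or.inr ⟨j, by omega⟩
  · have hk := hmin (i - 1) (by omega)
    by_cases heq : (mu.rowLen (i - 1) : ℤ) - (i - 1 : ℕ) - 1 = v
    · exact Or.inl ⟨i - 1, heq⟩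
    · have : i - 1 < mu.colLen j := by
        rw [← mem_iff_lt_colLen, mem_iff_lt_rowLen]
        omega
      exact Or.inr ⟨j, by omega⟩

theorem mem_iff_col_lt_row (mu : YoungDiagram) (i j : ℕ) :
    (i, j) ∈ mu ↔ (j - mu.colLen j : ℤ) < mu.rowLen i - i - 1 := by
  have h1 := mem_iff_lt_rowLen (μ := mu) (i := i) (j := j)
  have h2 := mem_iff_lt_colLen (μ := mu) (i := i) (j := j)
  by_cases h : (i, j) ∈ mu
  · have := h1.1 h
    have := h2.1 h
    simp only [h, true_iff]
    omega
  · have := mt h1.2 h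
    have := mt h2.2 h
    simp only [h, false_iff]
    omega

theorem row_ne_col (mu : YoungDiagram) (i j : ℕ) :
    (mu.rowLen i - i - 1 : ℤ) ≠ j - mu.colLen j := by
  have h1 := mem_iff_lt_rowLen (μ := mu) (i := i) (j := j)
  have h2 := mem_iff_lt_colLen (μ := mu) (i := i) (j := j)
  by_cases h : (i, j) ∈ mu
  · have := h1.1 h
    have := h2.1 h
    omega
  · have := mt h1.2 h
    have := mt h2.2 h
    omega

end YoungDiagram

namespace StrictPartition

theorem mem_parts_iff (lam : StrictPartition) {x : ℕ} :
    x ∈ lam.parts ↔ ∃ i < lam.length, lam.part i = x := by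
  simp only [List.mem_iff_getElem, part, length]
  constructor
  · rintro ⟨i, hi, rfl⟩
    exact ⟨i, hi, by simp [hi]⟩
  · rintro ⟨i, hi, rfl⟩
    exact ⟨i, hi, by simp [hi]⟩

theorem zero_notMem_parts (lam : StrictPartition) : 0 ∉ lam.parts :=
  fun h => (lam.pos 0 h).false

/-- The Maya diagram of the doubled distinct partition `λλ`, as a set of integers: the parts of
`λ`, and the negatives of the positive integers that are not parts. -/
def maya (lam : StrictPartition) : Set ℤ :=
  {x | (0 < x ∧ x.toNat ∈ lam.parts) ∨ (x < 0 ∧ (-x).toNat ∉ lam.parts)}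

theorem natCast_mem_maya (lam : StrictPartition) (k : ℕ) : (k : ℤ) ∈ lam.maya ↔ k ∈ lam.parts := by
  have h := lam.zero_notMem_parts
  rcases Nat.eq_zero_or_pos k with rfl | hk
  · simp [maya, h]
  · simp [maya, hk]

theorem zero_notMem_maya (lam : StrictPartition) : (0 : ℤ) ∉ lam.maya := by
  simp [maya]

theorem neg_mem_maya (lam : StrictPartition) {x : ℤ} (hx : x ≠ 0) :
    -x ∈ lam.maya ↔ x ∉ lam.maya := by
  rcases lt_or_gt_of_ne hx with h | h
  · simp [maya, h, h.not_gt]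
  · simp [maya, h, h.not_gt]

theorem exists_natCast_of_mem_maya (lam : StrictPartition) {x : ℤ} (hx : x ∈ lam.maya)
    (h0 : 0 < x) : ∃ k ∈ lam.parts, (k : ℤ) = x := by
  obtain ⟨k, rfl⟩ := Int.eq_ofNat_of_zero_le h0.le
  exact ⟨k, (lam.natCast_mem_maya k).1 hx, rfl⟩

theorem exists_forall_maya_le (lam : StrictPartition) : ∃ B : ℤ, ∀ x ∈ lam.maya, x ≤ B := by
  refine ⟨lam.parts.sum, fun x hx => ?_⟩
  rcases lt_or_ge 0 x with h | h
  · obtain ⟨k, hk, rfl⟩ := lam.exists_natCast_of_mem_maya hx h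
    exact_mod_cast List.single_le_sum (by simp) k hk
  · exact h.trans (by positivity)

theorem maya_injective : Function.Injective maya := by
  intro a b h
  ext1
  refine List.Perm.eq_of_pairwise (le := fun x y : ℕ => x > y)
    (fun x y _ _ h1 h2 => absurd h1 (Nat.lt_asymm h2)) a.strict b.strict ?_
  rw [List.perm_ext_iff_of_nodup (a.strict.imp fun h => h.ne')
    (b.strict.imp fun h => h.ne')]
  intro k
  rw [← natCast_mem_maya, ← natCast_mem_maya, h]

/-- A set of integers is the Maya diagram of a doubled distinct partition as soon as it is bounded
above and contains exactly one of `x` and `-x` for `x ≠ 0`, and not `0`. -/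
theorem exists_maya_eq (M : Set ℤ) (h0 : (0 : ℤ) ∉ M) (hneg : ∀ x, x ≠ 0 → (-x ∈ M ↔ x ∉ M))
    (B : ℤ) (hB : ∀ x ∈ M, x ≤ B) : ∃ lam : StrictPartition, lam.maya = M := by
  classical
  let S : Finset ℕ := (Finset.range (B.toNat + 1)).filter fun k => (k : ℤ) ∈ M
  have hS : ∀ k : ℕ, k ∈ S ↔ (k : ℤ) ∈ M := by
    intro k
    simp only [S, Finset.mem_filter, Finset.mem_range, and_iff_right_iff_imp]
    intro h
    have := hB k h
    omega
  let lam : StrictPartition :=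
    { parts := S.sort (· ≥ ·)
      strict := (S.sortedGT_sort).pairwise
      pos := by
        intro p hp
        rw [Finset.mem_sort, hS] at hp
        rcases Nat.eq_zero_or_pos p with rfl | h
        · exact absurd hp h0
        · exact h }
  have hmem : ∀ k : ℕ, (k : ℤ) ∈ lam.maya ↔ (k : ℤ) ∈ M := by
    intro k
    rw [natCast_mem_maya, ← hS]
    change k ∈ S.sort (· ≥ ·) ↔ k ∈ S
    exact Finset.mem_sort _
  refine ⟨lam, Set.ext fun x => ?_⟩
  obtain ⟨k, rfl | rfl⟩ := Int.eq_nat_or_neg x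
  · exact hmem k
  · rcases eq_or_ne (k : ℤ) 0 with hk | hk
    · rw [hk, neg_zero]
      exact iff_of_false lam.zero_notMem_maya h0
    · rw [neg_mem_maya lam hk, hneg _ hk, hmem]

/-- The exception `x = s / 2` is there because a bar length `λ_i + λ_j` requires `i ≠ j`. -/
theorem isBarCore_iff (lam : StrictPartition) {s : ℕ} (hs : 0 < s) :
    lam.IsBarCore s ↔ ∀ x ∈ lam.maya, 2 * x ≠ s → x - s ∈ lam.maya := by
  constructor
  · intro h x hx hxs
    by_contra hns
    rcases lt_or_ge 0 x with hx0 | hx0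
    · obtain ⟨k, hk, rfl⟩ := lam.exists_natCast_of_mem_maya hx hx0
      obtain ⟨i, hi, rfl⟩ := lam.mem_parts_iff.1 hk
      apply h i hi
      rcases le_or_gt s (lam.part i) with hle | hlt
      · right
        refine ⟨⟨hs, hle⟩, ?_⟩
        rintro ⟨j, hij, hj, hj'⟩
        have := lam.part_lt hij hj
        apply hns
        have e : ((lam.part i : ℤ) - s) = (lam.part j : ℕ) := by omega
        rw [e, natCast_mem_maya]
        exact lam.mem_parts_iff.2 ⟨j, hj, rfl⟩
      · exfalso
        rw [← neg_sub, neg_mem_maya _ (by omega), not_not] at hns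
        have e : ((s : ℤ) - lam.part i) = ((s - lam.part i : ℕ) : ℤ) := by omega
        rw [e, natCast_mem_maya, mem_parts_iff] at hns
        obtain ⟨j, hj, hj'⟩ := hns
        rcases lt_trichotomy i j with hij | rfl | hij
        · exact h i hi (Or.inl ⟨j, hij, hj, by omega⟩)
        · omega
        · exact h j hj (Or.inl ⟨i, hij, hi, by omega⟩)
    · have hx0' : x ≠ 0 := by
        rintro rfl
        exact lam.zero_notMem_maya hx
      rw [← neg_sub, neg_mem_maya _ (by omega), not_not] at hns
      obtain ⟨k, hk, hkx⟩ := lam.exists_natCast_of_mem_maya hns (by omega)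
      obtain ⟨i, hi, rfl⟩ := lam.mem_parts_iff.1 hk
      apply h i hi
      right
      refine ⟨⟨hs, by omega⟩, ?_⟩
      rintro ⟨j, hij, hj, hj'⟩
      have := lam.part_lt hij hj
      have hjm : (lam.part j : ℤ) ∈ lam.maya :=
        (lam.natCast_mem_maya _).2 (lam.mem_parts_iff.2 ⟨j, hj, rfl⟩)
      have e : (lam.part j : ℤ) = -x := by omega
      rw [e, neg_mem_maya _ hx0'] at hjm
      exact hjm hx
  · intro h i hi hs'
    have hmi : (lam.part i : ℤ) ∈ lam.maya :=
      (lam.natCast_mem_maya _).2 (lam.mem_parts_iff.2 ⟨i, hi, rfl⟩)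
    rcases hs' with ⟨j, hij, hj, hj'⟩ | ⟨⟨_, hle⟩, hne⟩
    · have hlt := lam.part_lt hij hj
      have hmj : (lam.part j : ℤ) ∈ lam.maya :=
        (lam.natCast_mem_maya _).2 (lam.mem_parts_iff.2 ⟨j, hj, rfl⟩)
      have := h _ hmi (by omega)
      have e : (lam.part i : ℤ) - s = -(lam.part j) := by omega
      have hp := lam.part_pos hj
      rw [e, neg_mem_maya _ (by omega)] at this
      exact this hmj
    · have := h _ hmi (by omega)
      have e : (lam.part i : ℤ) - s = (lam.part i - s : ℕ) := by omega
      rw [e, natCast_mem_maya, mem_parts_iff] at this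
      obtain ⟨j, hj, hj'⟩ := this
      have hp := lam.part_pos hj
      refine hne ⟨j, ?_, hj, by omega⟩
      by_contra hij
      have : lam.part i ≤ lam.part j := by
        rcases eq_or_lt_of_le (not_lt.1 hij) with rfl | h'
        · exact le_rfl
        · exact (lam.part_lt h' hi).le
      omega

theorem mem_doubled (lam : StrictPartition) (i j : ℕ) :
    (i, j) ∈ lam.doubled ↔
      (i < j ∧ i < lam.length ∧ j ≤ i + lam.part i) ∨
        (j ≤ i ∧ j < lam.length ∧ i < j + lam.part j) :=
  lam.mem_doubledCells i j

theorem rowLen_doubled (lam : StrictPartition) {i : ℕ} (hi : i < lam.length) :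
    lam.doubled.rowLen i = i + lam.part i + 1 := by
  have hp := lam.part_pos hi
  have h1 : (i, i + lam.part i) ∈ lam.doubled := (lam.mem_doubled _ _).2 (by omega)
  have h2 : ¬ (i, i + lam.part i + 1) ∈ lam.doubled := by
    rw [lam.mem_doubled]
    omega
  rw [YoungDiagram.mem_iff_lt_rowLen] at h1 h2
  omega

theorem colLen_doubled (lam : StrictPartition) {j : ℕ} (hj : j < lam.length) :
    lam.doubled.colLen j = j + lam.part j := by
  have hp := lam.part_pos hj
  have h1 : (j + lam.part j - 1, j) ∈ lam.doubled := (lam.mem_doubled _ _).2 (by omega)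
  have h2 : ¬ (j + lam.part j, j) ∈ lam.doubled := by
    rw [lam.mem_doubled]
    omega
  rw [YoungDiagram.mem_iff_lt_colLen] at h1 h2
  omega

theorem diag_mem_doubled (lam : StrictPartition) (i : ℕ) :
    (i, i) ∈ lam.doubled ↔ i < lam.length := by
  rw [mem_doubled]
  constructor
  · omega
  · intro h
    have := lam.part_pos h
    omega

theorem row_doubled_mem_maya (lam : StrictPartition) (i : ℕ) :
    (lam.doubled.rowLen i - i - 1 : ℤ) ∈ lam.maya := by
  by_cases hi : i < lam.length
  · have e : (lam.doubled.rowLen i - i - 1 : ℤ) = lam.part i := by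
      rw [lam.rowLen_doubled hi]
      push_cast
      ring
    rw [e, natCast_mem_maya, mem_parts_iff]
    exact ⟨i, hi, rfl⟩
  · have hd := mt (lam.diag_mem_doubled i).1 hi
    rw [YoungDiagram.mem_iff_lt_rowLen] at hd
    by_contra hn
    rw [← not_not (a := _ ∈ lam.maya), ← neg_mem_maya _ (by omega), not_not] at hn
    obtain ⟨k, hk, hke⟩ := lam.exists_natCast_of_mem_maya hn (by omega)
    obtain ⟨j, hj, rfl⟩ := lam.mem_parts_iff.1 hk
    have := lam.colLen_doubled hj
    exact lam.doubled.row_ne_col i j (by omega)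

theorem col_doubled_notMem_maya (lam : StrictPartition) (j : ℕ) :
    (j - lam.doubled.colLen j : ℤ) ∉ lam.maya := by
  intro hm
  rcases lt_or_ge 0 (j - lam.doubled.colLen j : ℤ) with h | h
  · obtain ⟨k, hk, hke⟩ := lam.exists_natCast_of_mem_maya hm h
    obtain ⟨i, hi, rfl⟩ := lam.mem_parts_iff.1 hk
    have := lam.rowLen_doubled hi
    exact lam.doubled.row_ne_col i j (by omega)
  · have hne : (j - lam.doubled.colLen j : ℤ) ≠ 0 := fun h0 => lam.zero_notMem_maya (h0 ▸ hm)
    have hd : (j, j) ∈ lam.doubled := by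
      rw [YoungDiagram.mem_iff_lt_colLen]
      omega
    have hj := (lam.diag_mem_doubled j).1 hd
    have e : (j - lam.doubled.colLen j : ℤ) = -(lam.part j : ℤ) := by
      rw [lam.colLen_doubled hj]
      push_cast
      ring
    have hp := lam.part_pos hj
    rw [e, neg_mem_maya _ (by omega), natCast_mem_maya, mem_parts_iff] at hm
    exact hm ⟨j, hj, rfl⟩

theorem mem_maya_iff_row (lam : StrictPartition) (x : ℤ) :
    x ∈ lam.maya ↔ ∃ i : ℕ, (lam.doubled.rowLen i - i - 1 : ℤ) = x := by
  constructor
  · intro hx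
    rcases lam.doubled.exists_row_or_col x with h | ⟨j, rfl⟩
    · exact h
    · exact absurd hx (lam.col_doubled_notMem_maya j)
  · rintro ⟨i, rfl⟩
    exact lam.row_doubled_mem_maya i

theorem notMem_maya_iff_col (lam : StrictPartition) (y : ℤ) :
    y ∉ lam.maya ↔ ∃ j : ℕ, (j - lam.doubled.colLen j : ℤ) = y := by
  constructor
  · intro hy
    rcases lam.doubled.exists_row_or_col y with ⟨i, rfl⟩ | h
    · exact absurd (lam.row_doubled_mem_maya i) hy
    · exact h
  · rintro ⟨j, rfl⟩
    exact lam.col_doubled_notMem_maya j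

/-- `λ` can be read off from the rows of `λλ`, through the Maya diagram. -/
theorem doubled_injective : Function.Injective doubled := by
  intro a b h
  apply maya_injective
  ext x
  rw [mem_maya_iff_row, mem_maya_iff_row, h]

theorem isCore_doubled_iff (lam : StrictPartition) {s : ℕ} (hs : 0 < s) :
    lam.doubled.IsCore s ↔ ∀ x ∈ lam.maya, x - s ∈ lam.maya := by
  constructor
  · intro h x hx
    by_contra hy
    obtain ⟨i, hi⟩ := (lam.mem_maya_iff_row x).1 hx
    obtain ⟨j, hj⟩ := (lam.notMem_maya_iff_col _).1 hy
    have hm : (i, j) ∈ lam.doubled := by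
      rw [YoungDiagram.mem_iff_col_lt_row]
      omega
    apply h (i, j) hm
    have := lam.doubled.hookLength_eq hm
    exact ⟨1, by dsimp only; omega⟩
  · rintro h ⟨i, j⟩ hm ⟨k, hk⟩
    have he := lam.doubled.hookLength_eq hm
    dsimp only at hk
    have hall : ∀ k : ℕ, (lam.doubled.rowLen i - i - 1 : ℤ) - s * k ∈ lam.maya := by
      intro k
      induction k with
      | zero => simpa using lam.row_doubled_mem_maya i
      | succ k ih =>
        have := h _ ih
        push_cast
        convert this using 1
        ring
    apply lam.col_doubled_notMem_maya j
    convert hall k using 1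
    rw [hk] at he
    push_cast at he
    linarith

/-- The box `(i, j)` of `S(λ)` is the box `(i, j + 1)` of `λλ`, and row `j + 1` of `S(λ)` becomes
the part of column `j + 1` of `λλ` below the diagonal. -/
theorem shiftedHookLength_eq (lam : StrictPartition) (i j : ℕ) (hij : i ≤ j) :
    lam.shiftedHookLength i j = lam.doubled.hookLength i (j + 1) := by
  refine Finset.card_bij' (fun c _ => if c.1 = j + 1 then (c.2, c.1) else (c.1, c.2 + 1))
    (fun c _ => if c.1 ≤ j then (c.1, c.2 - 1) else (c.2, c.1)) ?_ ?_ ?_ ?_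
  · rintro ⟨a, b⟩ h
    simp only [Finset.mem_filter, mem_shiftedDiagram] at h
    have : (lam.doubled).cells = lam.doubledCells := rfl
    split_ifs with h1 <;> (simp only at h1) <;>
      simp only [Finset.mem_filter, this, mem_doubledCells]
    · subst h1
      omega
    · omega
  · rintro ⟨a, b⟩ h
    have : (lam.doubled).cells = lam.doubledCells := rfl
    simp only [Finset.mem_filter, this, mem_doubledCells] at h
    split_ifs with h1 <;> (simp only at h1) <;>
      simp only [Finset.mem_filter, mem_shiftedDiagram]
    · omega
    · have hb : b = j + 1 := by omega
      subst hb
      omega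
  · rintro ⟨a, b⟩ h
    simp only [Finset.mem_filter, mem_shiftedDiagram] at h
    split_ifs <;> simp_all <;> omega
  · rintro ⟨a, b⟩ h
    have : (lam.doubled).cells = lam.doubledCells := rfl
    simp only [Finset.mem_filter, this, mem_doubledCells] at h
    split_ifs <;> simp_all
    omega

/-- The boxes of `S(λ)` are the boxes of `λλ` whose row label `x` and column label `y` satisfy
`|y| < x`, so this is the hook condition for them. -/
theorem isCSYD_iff_forall (lam : StrictPartition) (s : ℕ) :
    lam.IsCSYD s ↔ ∀ x ∈ lam.maya, ∀ y ∉ lam.maya, |y| < x → ¬ (s : ℤ) ∣ x - y := by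
  constructor
  · intro h x hx y hy hxy hdvd
    obtain ⟨hxy1, hxy2⟩ := abs_lt.1 hxy
    obtain ⟨i, hi⟩ := (lam.mem_maya_iff_row x).1 hx
    obtain ⟨j, hj⟩ := (lam.notMem_maya_iff_col y).1 hy
    have hm : (i, j) ∈ lam.doubled := by
      rw [YoungDiagram.mem_iff_col_lt_row]
      omega
    have hil : i < lam.length := by
      rw [← diag_mem_doubled, YoungDiagram.mem_iff_lt_rowLen]
      omega
    have hri := lam.rowLen_doubled hil
    have hij : i < j := by
      by_contra hij
      have hjl : j < lam.length := by omega
      have hcj := lam.colLen_doubled hjl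
      have := lam.add_part_le (not_lt.1 hij) hil
      omega
    obtain ⟨j, rfl⟩ : ∃ k, j = k + 1 := ⟨j - 1, by omega⟩
    have hm' : (i, j) ∈ lam.shiftedDiagram := by
      rw [mem_doubled] at hm
      rw [mem_shiftedDiagram]
      omega
    apply h _ hm'
    dsimp only
    rw [shiftedHookLength_eq _ _ _ (by omega), ← Int.natCast_dvd_natCast,
      YoungDiagram.hookLength_eq _ hm, hi, hj]
    exact hdvd
  · rintro h ⟨i, j⟩ hm hdvd
    rw [mem_shiftedDiagram] at hm
    dsimp only at hdvd
    have hm' : (i, j + 1) ∈ lam.doubled := by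
      rw [mem_doubled]
      omega
    rw [shiftedHookLength_eq _ _ _ (by omega), ← Int.natCast_dvd_natCast,
      YoungDiagram.hookLength_eq _ hm'] at hdvd
    refine h _ (lam.row_doubled_mem_maya i) _ (lam.col_doubled_notMem_maya (j + 1)) ?_ hdvd
    rw [YoungDiagram.mem_iff_col_lt_row] at hm'
    have hri := lam.rowLen_doubled hm.1
    refine abs_lt.2 ⟨?_, hm'⟩
    by_cases hjl : j + 1 < lam.length
    · have hcj := lam.colLen_doubled hjl
      have := lam.part_lt (show i < j + 1 by omega) hjl
      omega
    · have hd := mt (lam.diag_mem_doubled (j + 1)).1 hjl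
      rw [YoungDiagram.mem_iff_lt_colLen] at hd
      omega

/-- For odd `s` the second condition is void; for even `s` it excludes the part `3 s / 2`. -/
theorem isCSYD_iff (lam : StrictPartition) {s : ℕ} (hs : 0 < s) :
    lam.IsCSYD s ↔ lam.IsBarCore s ∧ ∀ x ∈ lam.maya, 2 * x ≠ 3 * s := by
  have hne : ∀ x ∈ lam.maya, x ≠ 0 := by
    rintro x hx rfl
    exact lam.zero_notMem_maya hx
  rw [isBarCore_iff _ hs]
  constructor
  · rw [isCSYD_iff_forall]
    intro h
    have h' : ∀ x ∈ lam.maya, ∀ y ∉ lam.maya, y < x → x + y ≠ 0 → ¬ (s : ℤ) ∣ x - y := by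
      intro x hx y hy hlt hxy hdvd
      rcases lt_or_gt_of_ne hxy with hneg | hpos
      · have hy0 : y ≠ 0 := by
          have := hne x hx
          omega
        refine h (-y) ((lam.neg_mem_maya hy0).2 hy) (-x) ?_ ?_ ?_
        · rw [neg_mem_maya _ (hne x hx), not_not]
          exact hx
        · exact abs_lt.2 (by omega)
        · convert hdvd using 1
          ring
      · exact h x hx y hy (abs_lt.2 (by omega)) hdvd
    constructor
    · intro x hx hxs
      by_contra hy
      exact h' x hx _ hy (by omega) (by omega) ⟨1, by ring⟩
    · intro x hx hx3
      have h1 : x - s ∈ lam.maya := by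
        by_contra hy
        exact h' x hx _ hy (by omega) (by omega) ⟨1, by ring⟩
      have h2 : x - 2 * s ∈ lam.maya := by
        by_contra hy
        exact h' x hx _ hy (by omega) (by omega) ⟨2, by ring⟩
      have e : x - 2 * s = -(x - s) := by omega
      rw [e, neg_mem_maya _ (hne _ h1)] at h2
      exact h2 h1
  · rintro ⟨h1, h3⟩
    have hall : ∀ x ∈ lam.maya, 2 * x ≠ s → ∀ k : ℕ, x - s * k ∈ lam.maya := by
      intro x hx hxs k
      suffices h : x - s * k ∈ lam.maya ∧ 2 * (x - s * k) ≠ s from h.1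
      induction k with
      | zero => simpa using ⟨hx, hxs⟩
      | succ k ih =>
        have e : x - s * ((k + 1 : ℕ) : ℤ) = x - s * k - s := by
          push_cast
          ring
        rw [e]
        refine ⟨h1 _ ih.1 ih.2, fun h => h3 _ ih.1 (by linarith)⟩
    rw [isCSYD_iff_forall]
    rintro x hx y hy hxy ⟨k, hk⟩
    obtain ⟨hxy1, hxy2⟩ := abs_lt.1 hxy
    obtain ⟨k, rfl⟩ : ∃ l : ℕ, (l : ℤ) = k :=
      ⟨k.toNat, Int.toNat_of_nonneg (by nlinarith)⟩
    by_cases hxs : 2 * x = s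
    · have hy0 : y ≠ 0 := by
        rintro rfl
        -- here `x = s / 2` would be a multiple of `s`
        rcases Nat.eq_zero_or_pos k with rfl | hk0
        · simp at hk
          omega
        · have : (s : ℤ) ≤ s * k := le_mul_of_one_le_right (by omega) (by omega)
          omega
      have := hall (-y) ((lam.neg_mem_maya hy0).2 hy) (by omega) k
      have e : -y - s * k = -x := by omega
      rw [e, neg_mem_maya _ (hne x hx)] at this
      exact this hx
    · apply hy
      convert hall x hx hxs k using 1
      omega

end StrictPartition

/-! ### Profiles of doubled distinct cores -/

theorem exists_eq_add_mul {n d : ℕ} (hcop : IsCoprime (n : ℤ) d) (x : ℤ) :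
    ∃ i j : ℤ, x = d * i + n * j := by
  obtain ⟨a, b, hab⟩ := hcop
  exact ⟨b * x, a * x, by linear_combination (-x) * hab⟩

namespace StrictPartition

/-- `lam.IsClosed k`: the Maya diagram of `λλ` is stable under subtraction of `k`, that is, `λλ` is
a `k`-core. -/
def IsClosed (lam : StrictPartition) (k : ℕ) : Prop :=
  ∀ x ∈ lam.maya, x - k ∈ lam.maya

/-- The profile of `λ` with respect to coprime `n` and `d`: every integer is `d i + n j` for some
`i` and `j`, and the profile at `i` is the largest `j` such that `d i + n j` lies in the Maya
diagram. It is meaningful only if the diagram is stable under subtraction of `n`. -/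
noncomputable def profile (n d : ℕ) (lam : StrictPartition) (i : ℤ) : ℤ :=
  sSup {j : ℤ | (d : ℤ) * i + n * j ∈ lam.maya}

end StrictPartition

/-- The properties that characterise the profiles of doubled distinct `n`-cores: the Maya diagram
omits `0`, the coordinates `(i + n, j - d)` and `(i, j)` describe the same integer, and exactly one
of `x` and `-x` lies in the Maya diagram if `x ≠ 0`. -/
structure IsProfile (n d : ℕ) (h : ℤ → ℤ) : Prop where
  zero : h 0 = -1
  add_period : ∀ i, h (i + n) = h i - d
  neg : ∀ i, ¬ (n : ℤ) ∣ i → h (-i) = -1 - h i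

namespace StrictPartition

variable {n d : ℕ} {lam : StrictPartition}

theorem IsClosed.sub_mul {k : ℕ} (hc : lam.IsClosed k) {x : ℤ} (hx : x ∈ lam.maya) (t : ℕ) :
    x - k * t ∈ lam.maya := by
  induction t with
  | zero => simpa using hx
  | succ t ih =>
    have := hc _ ih
    push_cast
    convert this using 1
    ring

theorem mem_maya_iff_le_profile (hn : 0 < n) (hc : lam.IsClosed n) (i j : ℤ) :
    (d : ℤ) * i + n * j ∈ lam.maya ↔ j ≤ lam.profile n d i := by
  obtain ⟨B, hB⟩ := lam.exists_forall_maya_le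
  have hn' : (1 : ℤ) ≤ n := by omega
  have hbdd : BddAbove {j : ℤ | (d : ℤ) * i + n * j ∈ lam.maya} := by
    refine ⟨|B - d * i|, fun j hj => ?_⟩
    have h1 := hB _ hj
    have h2 := le_abs_self (B - d * i)
    by_contra hlt
    nlinarith [abs_nonneg (B - d * i)]
  have hne : {j : ℤ | (d : ℤ) * i + n * j ∈ lam.maya}.Nonempty := by
    refine ⟨-(|B| + |d * i| + 1), ?_⟩
    have h1 := le_abs_self B
    have h2 := le_abs_self (d * i)
    have h3 : (|B| + |d * i| + 1) ≤ n * (|B| + |d * i| + 1) :=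
      le_mul_of_one_le_left (by positivity) hn'
    have h4 := abs_nonneg B
    by_contra hx
    simp only [Set.mem_ofPred_eq] at hx
    rw [← neg_mem_maya _ (by linarith)] at hx
    have := hB _ hx
    linarith
  constructor
  · intro h
    exact le_csSup hbdd h
  · intro h
    have hmem : (d : ℤ) * i + n * lam.profile n d i ∈ lam.maya := Int.csSup_mem hne hbdd
    have := hc.sub_mul hmem (lam.profile n d i - j).toNat
    rw [Int.toNat_of_nonneg (by omega)] at this
    convert this using 1
    ring

theorem isProfile_profile (hn : 0 < n) (hcop : IsCoprime (n : ℤ) d) (hc : lam.IsClosed n) :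
    IsProfile n d (lam.profile n d) := by
  have key := fun i j => mem_maya_iff_le_profile (d := d) hn hc i j
  constructor
  · have h0 : ¬ 0 ≤ lam.profile n d 0 := by
      rw [← key]
      simpa using lam.zero_notMem_maya
    have h1 : -1 ≤ lam.profile n d 0 := by
      rw [← key]
      have e : (d : ℤ) * 0 + n * -1 = -n := by ring
      rw [e, neg_mem_maya _ (by omega)]
      intro h
      have := hc _ h
      rw [sub_self] at this
      exact lam.zero_notMem_maya this
    omega
  · intro i
    refine eq_of_forall_le_iff fun j => ?_
    rw [le_sub_iff_add_le, ← key, ← key]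
    have e : (d : ℤ) * (i + n) + n * j = d * i + n * (j + d) := by ring
    rw [e]
  · intro i hi
    refine eq_of_forall_le_iff fun j => ?_
    have e : (d : ℤ) * -i + n * j = -(d * i + n * -j) := by ring
    have hne : (d : ℤ) * i + n * -j ≠ 0 := by
      intro h0
      exact hi (hcop.dvd_of_dvd_mul_left ⟨j, by linarith⟩)
    rw [← key, e, neg_mem_maya _ hne, key]
    omega

end StrictPartition

namespace IsProfile

variable {n d : ℕ} {h : ℤ → ℤ}

theorem add_mul_period (hh : IsProfile n d h) (i q : ℤ) : h (i + n * q) = h i - d * q := by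
  induction q using Int.induction_on with
  | zero => simp
  | succ q ih =>
    have := hh.add_period (i + n * q)
    rw [ih] at this
    convert this using 1
    · congr 1
      ring
    · ring
  | pred q ih =>
    have := hh.add_period (i + n * (-q - 1))
    have e : i + n * (-q - 1) + n = i + (n : ℤ) * -q := by ring
    rw [e, ih] at this
    linarith

theorem sub_eq (hh : IsProfile n d h) {i : ℤ} (hi : ¬ (n : ℤ) ∣ i) :
    h (n - i) = -1 - d - h i := by
  have h1 := hh.neg i hi
  have h2 := hh.add_period (-i)
  rw [neg_add_eq_sub] at h2
  linarith

theorem two_mul_half (hh : IsProfile n d h) {m : ℕ} (hm : 0 < m) (hnm : n = 2 * m) :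
    2 * h m = -1 - d := by
  have := hh.sub_eq (i := m) (fun hd => by
    have := Int.le_of_dvd (by omega) hd
    omega)
  have e : (n : ℤ) - m = m := by omega
  rw [e] at this
  linarith

theorem exists_maya_eq (hh : IsProfile n d h) (hn : 0 < n) (hcop : IsCoprime (n : ℤ) d) :
    ∃ lam : StrictPartition, ∀ i j : ℤ, (d : ℤ) * i + n * j ∈ lam.maya ↔ j ≤ h i := by
  let M : Set ℤ := {x | ∃ i j : ℤ, x = d * i + n * j ∧ j ≤ h i}
  have hM : ∀ i j : ℤ, (d : ℤ) * i + n * j ∈ M ↔ j ≤ h i := by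
    intro i j
    constructor
    · rintro ⟨i', j', he, hle⟩
      obtain ⟨q, hq⟩ : (n : ℤ) ∣ i' - i :=
        hcop.dvd_of_dvd_mul_left ⟨j - j', by linarith⟩
      have hi' : i' = i + n * q := by omega
      rw [hi', hh.add_mul_period] at hle
      have : (n : ℤ) * j = n * (j' + d * q) := by
        rw [hi'] at he
        linarith
      have := mul_left_cancel₀ (by omega) this
      omega
    · intro hle
      exact ⟨i, j, rfl, hle⟩
  obtain ⟨B, hB⟩ : ∃ B : ℤ, ∀ x ∈ M, x ≤ B := by
    obtain ⟨C, hC⟩ := ((Set.finite_Ico (0 : ℤ) n).image h).bddAbove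
    refine ⟨d * n + n * |C|, ?_⟩
    rintro x ⟨i, j, rfl, hle⟩
    have hdiv := Int.emod_add_mul_ediv i n
    have h1 := Int.emod_nonneg i (show (n : ℤ) ≠ 0 by omega)
    have h2 := Int.emod_lt_of_pos i (show (0 : ℤ) < n by omega)
    have h3 := hC ⟨i % n, ⟨h1, h2⟩, rfl⟩
    have h4 := hh.add_mul_period (i % n) (i / n)
    rw [hdiv] at h4
    have h5 := le_abs_self C
    have e : (d : ℤ) * i + n * j = d * (i % n) + n * (j + d * (i / n)) := by
      nth_rewrite 1 [← hdiv]
      ring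
    rw [e]
    have h6 : (d : ℤ) * (i % n) ≤ d * n := mul_le_mul_of_nonneg_left h2.le (by positivity)
    have h7 : (n : ℤ) * (j + d * (i / n)) ≤ n * |C| :=
      mul_le_mul_of_nonneg_left (by linarith) (by positivity)
    linarith
  obtain ⟨lam, hlam⟩ := StrictPartition.exists_maya_eq M
    (by
      have := hM 0 0
      rw [hh.zero] at this
      simpa using this)
    (by
      intro x hx
      obtain ⟨i, j, rfl⟩ := exists_eq_add_mul hcop x
      have e : -((d : ℤ) * i + n * j) = d * -i + n * -j := by ring
      rw [e, hM, hM]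
      by_cases hi : (n : ℤ) ∣ i
      · obtain ⟨q, rfl⟩ := hi
        have e1 := hh.add_mul_period 0 q
        have e2 := hh.add_mul_period 0 (-q)
        rw [zero_add, hh.zero] at e1 e2
        have e3 : -((n : ℤ) * q) = n * -q := by ring
        rw [e3, e1, e2]
        have : j + d * q ≠ 0 := by
          intro h0
          apply hx
          linear_combination (n : ℤ) * h0
        rw [mul_neg]
        omega
      · rw [hh.neg i hi]
        omega)
    B hB
  exact ⟨lam, fun i j => by rw [hlam, hM]⟩

/-- Extension of a sequence on `0, …, n / 2` to a profile: by reflection to `0, …, n - 1`, and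
then quasi-periodically to all integers. -/
def fold (n d : ℕ) (p : ℤ → ℤ) (i : ℤ) : ℤ :=
  (if i % n ≤ (n / 2 : ℕ) then p (i % n) else -1 - d - p (n - i % n)) - d * (i / n)

theorem eq_fold (hh : IsProfile n d h) (hn : 0 < n) : h = fold n d h := by
  funext i
  have hdiv := Int.emod_add_mul_ediv i n
  have h1 := Int.emod_nonneg i (show (n : ℤ) ≠ 0 by omega)
  have h2 := Int.emod_lt_of_pos i (show (0 : ℤ) < n by omega)
  have h4 := hh.add_mul_period (i % n) (i / n)
  rw [hdiv] at h4
  rw [fold, h4]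
  split_ifs with hle
  · rfl
  · have h5 := hh.sub_eq (i := n - i % n) (fun hd => by
      have := Int.le_of_dvd (by omega) hd
      omega)
    rw [sub_sub_cancel] at h5
    rw [h5]

theorem isProfile_fold (hn : 0 < n) {p : ℤ → ℤ} (h0 : p 0 = -1)
    (hmid : Even n → 2 * p (n / 2 : ℕ) = -1 - d) : IsProfile n d (fold n d p) := by
  have hn' : (n : ℤ) ≠ 0 := by omega
  constructor
  · rw [fold, Int.zero_emod, if_pos (by positivity), h0, Int.zero_ediv, mul_zero, sub_zero]
  · intro i
    simp only [fold]
    rw [Int.add_emod_right, Int.add_ediv_of_dvd_right (dvd_refl _), Int.ediv_self hn']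
    ring
  · intro i hi
    have h1 := Int.emod_nonneg i hn'
    have h2 := Int.emod_lt_of_pos i (show (0 : ℤ) < n by omega)
    have h3 : i % n ≠ 0 := fun h => hi (Int.dvd_of_emod_eq_zero h)
    have hdiv := Int.emod_add_mul_ediv i n
    have e : -i = (n - i % n) + n * (-(i / n) - 1) := by linarith
    have hmod : -i % n = n - i % n := by
      rw [e, Int.add_mul_emod_self_left, Int.emod_eq_of_lt (by omega) (by omega)]
    have hquo : -i / n = -(i / n) - 1 := by
      rw [e, Int.add_mul_ediv_left _ _ hn', Int.ediv_eq_zero_of_lt (by omega) (by omega), zero_add]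
    simp only [fold]
    rw [hmod, hquo, sub_sub_cancel]
    split_ifs with ha hb hb
    · have hev : Even n := ⟨n / 2, by omega⟩
      have e1 : i % n = (n / 2 : ℕ) := by omega
      have e2 : n - i % n = (n / 2 : ℕ) := by omega
      have := hmid hev
      rw [e2, e1]
      linarith
    · ring
    · ring
    · omega

/-- All steps of `h` are `-1`, `0` or `1`, except possibly those from `(n - 1) / 2` to
`(n + 1) / 2` modulo `n`, which exist when `n` is odd. -/
def HasUnitSteps (n : ℕ) (h : ℤ → ℤ) : Prop :=
  ∀ i : ℤ, ¬ (n : ℤ) ∣ 2 * i + 1 → |h (i + 1) - h i| ≤ 1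

/-- By periodicity and reflection, only the steps on `0, …, n / 2` matter, and the step from `-1`
to `0` mirrors the one from `0` to `1`, which excludes the value `-2` at `1`. -/
theorem hasUnitSteps_iff (hh : IsProfile n d h) (hn : 2 ≤ n) :
    HasUnitSteps n h ↔ (h 1 = -1 ∨ h 1 = 0) ∧
      ∀ i : ℕ, i < n / 2 → |h (i + 1 : ℕ) - h i| ≤ 1 := by
  have hndvd : ∀ t : ℤ, 0 < t → t < n → ¬ (n : ℤ) ∣ t := by
    intro t h1 h2 hd
    have := Int.le_of_dvd h1 hd
    omega
  have h1 := hh.neg 1 (hndvd 1 (by omega) (by omega))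
  have h0 := hh.zero
  constructor
  · intro hst
    refine ⟨?_, fun i hi => ?_⟩
    · have ha := hst 0 (by simpa using hndvd 1 (by omega) (by omega))
      have hb := hst (-1) (by
        have := hndvd 1 (by omega) (by omega)
        rwa [← dvd_neg] at this)
      rw [zero_add, h0] at ha
      rw [neg_add_cancel, h0, h1] at hb
      rw [abs_le] at ha hb
      omega
    · have := hst i (hndvd _ (by omega) (by omega))
      exact_mod_cast this
  · rintro ⟨hone, hst⟩ i hi
    have hdiv := Int.emod_add_mul_ediv i n
    have hr0 := Int.emod_nonneg i (show (n : ℤ) ≠ 0 by omega)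
    have hrn := Int.emod_lt_of_pos i (show (0 : ℤ) < n by omega)
    obtain ⟨r, hr⟩ := Int.eq_ofNat_of_zero_le hr0
    rw [hr] at hdiv hrn
    have e1 : h i = h r - d * (i / n) := by
      rw [← hh.add_mul_period, hdiv]
    have e2 : h (i + 1) = h (r + 1 : ℕ) - d * (i / n) := by
      rw [← hh.add_mul_period]
      congr 1
      push_cast
      linarith
    have hodd : 2 * r + 1 ≠ n := by
      intro h
      apply hi
      refine ⟨1 + 2 * (i / n), ?_⟩
      have : (2 * r + 1 : ℤ) = n := by exact_mod_cast h
      linear_combination -2 * hdiv + this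
    rw [e1, e2, sub_sub_sub_cancel_right]
    rcases lt_or_ge r (n / 2) with hlt | hge
    · exact hst r hlt
    · obtain ⟨t, ht⟩ : ∃ t : ℕ, t + r + 1 = n := ⟨n - r - 1, by omega⟩
      have e3 : h r = -1 - d - h (t + 1 : ℕ) := by
        rw [← hh.sub_eq (hndvd _ (by omega) (by omega))]
        congr 1
        omega
      rcases Nat.eq_zero_or_pos t with rfl | ht0
      · have e4 : h (r + 1 : ℕ) = -1 - d := by
          have := hh.add_period 0
          rw [zero_add, h0] at this
          rw [← this]
          congr 1
          omega
        rw [e3, e4, abs_le]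
        simp only [zero_add, Nat.cast_one]
        omega
      · have e4 : h (r + 1 : ℕ) = -1 - d - h t := by
          rw [← hh.sub_eq (hndvd _ (by omega) (by omega))]
          congr 1
          omega
        have := hst t (by omega)
        rw [e3, e4]
        convert this using 1
        congr 1
        ring

end IsProfile

/-! ### Profiles as lattice paths -/

/-- The number of walks on `ℤ` with `N` steps, each `-1`, `0` or `1`, from `0` to `z`. -/
def walkCount : ℕ → ℤ → ℕ
  | 0, z => if z = 0 then 1 else 0
  | N + 1, z => walkCount N (z - 1) + walkCount N z + walkCount N (z + 1)

theorem walkCount_neg (N : ℕ) (z : ℤ) : walkCount N (-z) = walkCount N z := by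
  induction N generalizing z with
  | zero => simp [walkCount]
  | succ N ih =>
    have e1 : -z - 1 = -(z + 1) := by ring
    have e2 : -z + 1 = -(z - 1) := by ring
    rw [walkCount, walkCount, e1, e2, ih, ih, ih]
    ring

/-- The sequences `p` with unit steps, with `p 0 = -1` and `p 1 ∈ {-1, 0}`, that reach `v` at
time `k` and stay there. They are the restrictions of profiles to `0, …, k`. -/
def profilePaths (k : ℕ) (v : ℤ) : Set (ℕ → ℤ) :=
  {p | p 0 = -1 ∧ (p 1 = -1 ∨ p 1 = 0) ∧ (∀ i < k, |p (i + 1) - p i| ≤ 1) ∧ ∀ i, k ≤ i → p i = v}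

theorem encard_sep_abs_sub_le_one {α : Type*} (S : Set α) (f : α → ℤ) (c : ℤ) :
    {x ∈ S | |f x - c| ≤ 1}.encard =
      {x ∈ S | f x = c - 1}.encard + {x ∈ S | f x = c}.encard + {x ∈ S | f x = c + 1}.encard := by
  have hunion : {x ∈ S | |f x - c| ≤ 1} =
      ({x ∈ S | f x = c - 1} ∪ {x ∈ S | f x = c}) ∪ {x ∈ S | f x = c + 1} := by
    ext x
    simp only [Set.mem_union, Set.mem_sep_iff, abs_le]
    constructor
    · rintro ⟨hx, h⟩
      simp only [hx, true_and]
      omega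
    · rintro ((⟨hx, h⟩ | ⟨hx, h⟩) | ⟨hx, h⟩) <;> exact ⟨hx, by omega⟩
  rw [hunion, Set.encard_union_eq, Set.encard_union_eq]
  all_goals
    rw [Set.disjoint_left]
    intro p h1 h2
    simp only [Set.mem_union, Set.mem_sep_iff] at h1 h2
    omega

/-- Removing the last step is a bijection onto the paths of length `k`. -/
theorem encard_profilePaths_sep {k : ℕ} (hk : 0 < k) {u v : ℤ} (huv : |v - u| ≤ 1) :
    {p ∈ profilePaths (k + 1) v | p k = u}.encard = (profilePaths k u).encard := by
  have himg : {p ∈ profilePaths (k + 1) v | p k = u} =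
      (fun (q : ℕ → ℤ) i => if i ≤ k then q i else v) '' profilePaths k u := by
    ext p
    constructor
    · rintro ⟨⟨h0, h1, hst, hend⟩, hpk⟩
      refine ⟨fun i => p (min i k), ⟨by simpa using h0, ?_, ?_, ?_⟩, ?_⟩
      · simp only [show min 1 k = 1 by omega]
        exact h1
      · intro i hi
        simp only [show min (i + 1) k = i + 1 by omega, show min i k = i by omega]
        exact hst i (by omega)
      · intro i hi
        simp only [show min i k = k by omega]
        exact hpk
      · funext i
        dsimp only
        split_ifs with hi
        · rw [show min i k = i by omega]
        · exact (hend i (by omega)).symm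
    · rintro ⟨q, ⟨h0, h1, hst, hend⟩, rfl⟩
      refine ⟨⟨by simpa using h0, ?_, ?_, ?_⟩, ?_⟩
      · dsimp only
        rw [if_pos (by omega)]
        exact h1
      · intro i hi
        dsimp only
        rw [if_pos (show i ≤ k by omega)]
        split_ifs with hik
        · exact hst i (by omega)
        · rw [show i = k by omega, hend k le_rfl]
          exact huv
      · intro i hi
        dsimp only
        rw [if_neg (by omega)]
      · dsimp only
        rw [if_pos le_rfl, hend k le_rfl]
  rw [himg]
  refine Set.InjOn.encard_image ?_
  rintro q ⟨-, -, -, hq⟩ q' ⟨-, -, -, hq'⟩ h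
  funext i
  rcases le_or_gt i k with hi | hi
  · have := congrFun h i
    dsimp only at this
    rwa [if_pos hi, if_pos hi] at this
  · rw [hq i hi.le, hq' i hi.le]

theorem encard_profilePaths (N : ℕ) (v : ℤ) :
    (profilePaths (N + 1) v).encard = (walkCount N (v + 1) + walkCount N v : ℕ) := by
  induction N generalizing v with
  | zero =>
    simp only [walkCount]
    have hsub : ∀ p ∈ profilePaths 1 v, p = fun i => if i = 0 then -1 else v := by
      rintro p ⟨h0, -, -, hend⟩
      funext i
      split_ifs with hi
      · rw [hi, h0]
      · exact hend i (by omega)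
    by_cases hv : v = -1 ∨ v = 0
    · have : profilePaths (0 + 1) v = {fun i => if i = 0 then -1 else v} := by
        refine Set.eq_singleton_iff_unique_mem.2 ⟨⟨rfl, ?_, ?_, ?_⟩, hsub⟩
        · simpa using hv
        · intro i hi
          obtain rfl : i = 0 := by omega
          rcases hv with rfl | rfl <;> simp
        · intro i hi
          simp [show i ≠ 0 by omega]
      rw [this, Set.encard_singleton]
      rcases hv with rfl | rfl <;> simp
    · have : profilePaths (0 + 1) v = ∅ := by
        refine Set.eq_empty_of_forall_notMem ?_
        rintro p ⟨-, h1, -, hend⟩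
        rw [hend 1 le_rfl] at h1
        exact hv h1
      rw [this, Set.encard_empty, if_neg (by omega), if_neg (by omega)]
      rfl
  | succ N ih =>
    have hlast : profilePaths (N + 1 + 1) v =
        {p ∈ profilePaths (N + 1 + 1) v | |p (N + 1) - v| ≤ 1} := by
      refine (Set.sep_eq_self_iff_mem_true.2 fun p hp => ?_).symm
      have h1 := hp.2.2.1 (N + 1) (by omega)
      rwa [hp.2.2.2 (N + 1 + 1) le_rfl, abs_sub_comm] at h1
    rw [hlast, encard_sep_abs_sub_le_one, encard_profilePaths_sep, ih,
      encard_profilePaths_sep, ih, encard_profilePaths_sep, ih]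
    · simp only [walkCount]
      norm_cast
      rw [sub_add_cancel, add_sub_cancel_right]
      ring
    all_goals solve | omega | simp

namespace StrictPartition

open IsProfile

/-- The strict partitions `λ` such that `λλ` is an `n`-core and the profile of `λ` has unit
steps, except possibly at the middle step. -/
def unitStepCores (n d : ℕ) : Set StrictPartition :=
  {lam | lam.IsClosed n ∧ HasUnitSteps n (lam.profile n d)}

/-- The doubled distinct `n`-cores whose profile has unit steps and a prescribed value at `n / 2`
correspond to their profiles on `0, …, n / 2`. -/
theorem encard_hasUnitSteps_sep {n d : ℕ} (hn : 2 ≤ n) (hcop : IsCoprime (n : ℤ) d) (v : ℤ)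
    (hv : Even n → 2 * v = -1 - d) (Q : (ℕ → ℤ) → Prop) :
    {lam ∈ unitStepCores n d | lam.profile n d (n / 2 : ℕ) = v ∧
      Q fun i => lam.profile n d (min i (n / 2) : ℕ)}.encard =
      {p ∈ profilePaths (n / 2) v | Q p}.encard := by
  have hn0 : 0 < n := by omega
  have hinj : Set.InjOn (fun (lam : StrictPartition) (i : ℕ) =>
      lam.profile n d (min i (n / 2) : ℕ)) {lam ∈ unitStepCores n d |
        lam.profile n d (n / 2 : ℕ) = v ∧ Q fun i => lam.profile n d (min i (n / 2) : ℕ)} := by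
    rintro lam ⟨⟨hc, -⟩, -⟩ lam' ⟨⟨hc', -⟩, -⟩ h
    have hp := isProfile_profile hn0 hcop hc
    have hp' := isProfile_profile hn0 hcop hc'
    have heq : ∀ t : ℤ, 0 ≤ t → t ≤ (n / 2 : ℕ) → lam.profile n d t = lam'.profile n d t := by
      intro t h0 h1
      obtain ⟨i, rfl⟩ := Int.eq_ofNat_of_zero_le h0
      have := congrFun h i
      dsimp only at this
      rwa [show min i (n / 2) = i by omega] at this
    have hfun : lam.profile n d = lam'.profile n d := by
      rw [hp.eq_fold hn0, hp'.eq_fold hn0]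
      funext i
      have h1 := Int.emod_nonneg i (show (n : ℤ) ≠ 0 by omega)
      have h2 := Int.emod_lt_of_pos i (show (0 : ℤ) < n by omega)
      simp only [fold]
      split_ifs with hle
      · rw [heq _ h1 hle]
      · rw [heq _ (by omega) (by omega)]
    apply maya_injective
    ext x
    obtain ⟨i, j, rfl⟩ := exists_eq_add_mul hcop x
    rw [mem_maya_iff_le_profile hn0 hc, mem_maya_iff_le_profile hn0 hc', hfun]
  rw [← hinj.encard_image]
  congr 1
  ext p
  constructor
  · rintro ⟨lam, ⟨⟨hc, hst⟩, hend, hQ⟩, rfl⟩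
    have hp := isProfile_profile hn0 hcop hc
    obtain ⟨h1, h2⟩ := (hp.hasUnitSteps_iff hn).1 hst
    refine ⟨⟨?_, ?_, ?_, ?_⟩, hQ⟩
    · simpa using hp.zero
    · dsimp only
      rw [show min 1 (n / 2) = 1 by omega]
      exact h1
    · intro i hi
      dsimp only
      rw [show min i (n / 2) = i by omega, show min (i + 1) (n / 2) = i + 1 by omega]
      exact h2 i hi
    · intro i hi
      dsimp only
      rw [show min i (n / 2) = n / 2 by omega]
      exact hend
  · rintro ⟨⟨h0, h1, hst, hend⟩, hQ⟩
    have hf : IsProfile n d (fold n d fun t => p t.toNat) := by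
      refine isProfile_fold hn0 (by simpa using h0) fun hev => ?_
      rw [Int.toNat_natCast, hend _ le_rfl, hv hev]
    obtain ⟨lam, hlam⟩ := hf.exists_maya_eq hn0 hcop
    have hval : ∀ i : ℕ, i ≤ n / 2 → fold n d (fun t => p t.toNat) i = p i := by
      intro i hi
      simp only [fold]
      rw [Int.emod_eq_of_lt (by omega) (by omega), Int.ediv_eq_zero_of_lt (by omega) (by omega),
        if_pos (by omega), Int.toNat_natCast]
      ring
    have hc : lam.IsClosed n := by
      intro x hx
      obtain ⟨i, j, rfl⟩ := exists_eq_add_mul hcop x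
      rw [hlam] at hx
      rw [show (d : ℤ) * i + n * j - n = d * i + n * (j - 1) by ring, hlam]
      omega
    have hprof : lam.profile n d = fold n d fun t => p t.toNat := by
      funext i
      refine eq_of_forall_le_iff fun j => ?_
      rw [← mem_maya_iff_le_profile hn0 hc, hlam]
    have hres : (fun i : ℕ => lam.profile n d (min i (n / 2) : ℕ)) = p := by
      funext i
      rw [hprof, hval _ (by omega)]
      rcases le_or_gt i (n / 2) with hi | hi
      · rw [min_eq_left hi]
      · rw [min_eq_right hi.le, hend _ le_rfl, hend _ hi.le]
    refine ⟨lam, ⟨⟨hc, ?_⟩, ?_, ?_⟩, hres⟩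
    · rw [hprof, hf.hasUnitSteps_iff hn]
      refine ⟨?_, fun i hi => ?_⟩
      · have := hval 1 (by omega)
        rw [Nat.cast_one] at this
        rw [this]
        exact h1
      · rw [hval _ (by omega), hval _ (by omega)]
        exact hst i hi
    · rw [hprof, hval _ le_rfl, hend _ le_rfl]
    · rw [hres]
      exact hQ

variable {n d : ℕ}

theorem encard_profile_half_eq (hn : 2 ≤ n) (hcop : IsCoprime (n : ℤ) d) (v : ℤ)
    (hv : Even n → 2 * v = -1 - d) :
    {lam ∈ unitStepCores n d | lam.profile n d (n / 2 : ℕ) = v}.encard =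
      (walkCount (n / 2 - 1) (v + 1) + walkCount (n / 2 - 1) v : ℕ) := by
  have := encard_hasUnitSteps_sep hn hcop v hv fun _ => True
  simp only [and_true] at this
  change _ = (profilePaths (n / 2) v).encard at this
  rw [this, ← encard_profilePaths, Nat.sub_add_cancel (by omega)]

theorem encard_profile_pred_half_eq (hn : 4 ≤ n) (hcop : IsCoprime (n : ℤ) d) (u v : ℤ)
    (hv : Even n → 2 * v = -1 - d) (huv : |v - u| ≤ 1) :
    {lam ∈ unitStepCores n d | lam.profile n d (n / 2 : ℕ) = v ∧ lam.profile n d (n / 2 - 1 : ℕ) = u}.encard =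
      (walkCount (n / 2 - 2) (u + 1) + walkCount (n / 2 - 2) u : ℕ) := by
  have := encard_hasUnitSteps_sep (by omega) hcop v hv fun p => p (n / 2 - 1) = u
  simp only [show min (n / 2 - 1) (n / 2) = n / 2 - 1 by omega] at this
  rw [this, ← encard_profilePaths, show n / 2 - 2 + 1 = n / 2 - 1 by omega,
    ← encard_profilePaths_sep (by omega) huv, Nat.sub_add_cancel (by omega)]

end StrictPartition

/-! ### Binomial sums counting walks -/

theorem sum_range_even_add_odd (f : ℕ → ℕ) (L : ℕ) :
    ∑ i ∈ Finset.range L, f i =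
      ∑ a ∈ Finset.range ((L + 1) / 2), f (2 * a) + ∑ a ∈ Finset.range (L / 2), f (2 * a + 1) := by
  induction L with
  | zero => simp
  | succ L ih =>
    rw [Finset.sum_range_succ, ih]
    rcases Nat.even_or_odd' L with ⟨k, rfl | rfl⟩
    · rw [show (2 * k + 1) / 2 = k by omega, show 2 * k / 2 = k by omega,
        show (2 * k + 1 + 1) / 2 = k + 1 by omega, Finset.sum_range_succ]
      ring
    · rw [show (2 * k + 1 + 1) / 2 = k + 1 by omega, show (2 * k + 1) / 2 = k by omega,
        show (2 * k + 1 + 1 + 1) / 2 = k + 1 by omega,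
        Finset.sum_range_succ (fun a => f (2 * a + 1))]
      ring

theorem sum_choose_mul_choose_succ (N j B : ℕ) :
    ∑ a ∈ Finset.range (B + 1), N.choose (2 * a + j) * (2 * a + j + 1).choose a =
      ∑ a ∈ Finset.range (B + 1), N.choose (2 * a + j) * (2 * a + j).choose a +
        ∑ a ∈ Finset.range B, N.choose (2 * a + (j + 2)) * (2 * a + (j + 2)).choose a := by
  have h : ∑ a ∈ Finset.range B,
      N.choose (2 * (a + 1) + j) * (2 * (a + 1) + j + 1).choose (a + 1) =
        ∑ a ∈ Finset.range B, N.choose (2 * (a + 1) + j) * (2 * (a + 1) + j).choose (a + 1) +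
          ∑ a ∈ Finset.range B, N.choose (2 * a + (j + 2)) * (2 * a + (j + 2)).choose a := by
    rw [← Finset.sum_add_distrib]
    refine Finset.sum_congr rfl fun a _ => ?_
    rw [Nat.choose_succ_succ, show 2 * (a + 1) + j = 2 * a + (j + 2) by ring]
    ring
  rw [Finset.sum_range_succ', Finset.sum_range_succ' (fun a =>
    N.choose (2 * a + j) * (2 * a + j).choose a), h]
  simp only [Nat.choose_zero_right]
  ring

/-- A walk from `0` to `k` with `a` steps `-1` has `a + k` steps `1`. -/
theorem walkCount_eq_sum (N k B : ℕ) (hB : N < 2 * B + k) :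
    walkCount N k = ∑ a ∈ Finset.range B, N.choose (2 * a + k) * (2 * a + k).choose a := by
  induction N generalizing k B with
  | zero =>
    rcases Nat.eq_zero_or_pos k with rfl | hk
    · obtain ⟨B, rfl⟩ : ∃ B', B = B' + 1 := ⟨B - 1, by omega⟩
      rw [Finset.sum_range_succ', Finset.sum_eq_zero]
      · simp [walkCount]
      · intro a _
        rw [Nat.choose_eq_zero_of_lt (by omega), zero_mul]
    · rw [Finset.sum_eq_zero]
      · simp [walkCount, hk.ne']
      · intro a _
        rw [Nat.choose_eq_zero_of_lt (by omega), zero_mul]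
  | succ N ih =>
    rw [walkCount]
    rcases Nat.eq_zero_or_pos k with rfl | hk
    · obtain ⟨B, rfl⟩ : ∃ B', B = B' + 1 := ⟨B - 1, by omega⟩
      have e1 : ((0 : ℕ) : ℤ) - 1 = -((1 : ℕ) : ℤ) := by simp
      have e2 : ((0 : ℕ) : ℤ) + 1 = ((1 : ℕ) : ℤ) := by simp
      rw [e1, walkCount_neg, e2, ih 1 B (by omega), ih 0 (B + 1) (by omega),
        Finset.sum_range_succ', Finset.sum_range_succ', add_right_comm, ← add_assoc, add_right_comm,
        ← Finset.sum_add_distrib, add_right_comm, ← Finset.sum_add_distrib]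
      congr 1
      swap
      · simp
      refine Finset.sum_congr rfl fun a _ => ?_
      have hsymm : (2 * a + 1).choose (a + 1) = (2 * a + 1).choose a :=
        Nat.choose_symm_half a
      rw [show 2 * (a + 1) + 0 = 2 * a + 1 + 1 by ring, Nat.choose_succ_succ N,
        Nat.choose_succ_succ (2 * a + 1), hsymm]
      ring
    · obtain ⟨j, rfl⟩ : ∃ j, k = j + 1 := ⟨k - 1, by omega⟩
      have e1 : ((j + 1 : ℕ) : ℤ) - 1 = (j : ℕ) := by simp
      have e2 : ((j + 1 : ℕ) : ℤ) + 1 = ((j + 2 : ℕ) : ℤ) := by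
        push_cast
        ring
      rw [e1, e2]
      rcases Nat.eq_zero_or_pos B with rfl | hB0
      · rw [ih j 0 (by omega), ih (j + 1) 0 (by omega), ih (j + 2) 0 (by omega)]
        rfl
      · obtain ⟨B, rfl⟩ : ∃ B', B = B' + 1 := ⟨B - 1, by omega⟩
        have h := sum_choose_mul_choose_succ N j B
        rw [ih j (B + 1) (by omega), ih (j + 1) (B + 1) (by omega), ih (j + 2) B (by omega),
          add_right_comm, ← h, ← Finset.sum_add_distrib]
        refine Finset.sum_congr rfl fun a _ => ?_
        rw [← add_assoc, Nat.choose_succ_succ N]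
        ring

/-- The even and the odd terms count the walks from `0` to `D` and to `D + 1`, in both cases by
the number of nonzero steps. -/
theorem sum_choose_mul_choose (N D L : ℕ) (hN : N < D + L) :
    ∑ i ∈ Finset.range L, (D + i).choose (i / 2) * N.choose (D + i) =
      walkCount N D + walkCount N (D + 1) := by
  have e : ((D : ℤ) + 1) = (D + 1 : ℕ) := by simp
  rw [sum_range_even_add_odd, walkCount_eq_sum N D ((L + 1) / 2) (by omega), e,
    walkCount_eq_sum N (D + 1) (L / 2) (by omega)]
  congr 1 <;> refine Finset.sum_congr rfl fun a _ => ?_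
  · rw [show 2 * a / 2 = a by omega, add_comm D, mul_comm]
  · rw [show (2 * a + 1) / 2 = a by omega, show D + (2 * a + 1) = 2 * a + (D + 1) by ring, mul_comm]

theorem trinomial_eq (n a b c : ℕ) (h : a + b + c = n) :
    trinomial n a b c = (a + b).choose a * n.choose (a + b) := by
  subst h
  rw [trinomial, if_pos rfl]
  have h1 := Nat.add_choose_mul_factorial_mul_factorial (a + b) c
  have h2 := Nat.add_choose_mul_factorial_mul_factorial a b
  refine Nat.div_eq_of_eq_mul_left (by positivity) ?_
  rw [← h1, ← h2, Nat.choose_symm_add, Nat.choose_symm_add]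
  ring

theorem sum_trinomial (N D L : ℕ) (hN : N = D + L) :
    ∑ i ∈ Finset.range (L + 1), trinomial N (i / 2) ((2 * D + 1 + i) / 2) (L - i) =
      walkCount N D + walkCount N (D + 1) := by
  rw [← sum_choose_mul_choose N D (L + 1) (by omega)]
  refine Finset.sum_congr rfl fun i hi => ?_
  have := Finset.mem_range.1 hi
  rw [trinomial_eq _ _ _ _ (by omega), show i / 2 + (2 * D + 1 + i) / 2 = D + i by omega]

/-- Choosing the `-1` steps first and then the `0` steps. -/
theorem sum_choose_mul_choose_sub (N D L : ℕ) (hN : N + 1 = D + L) :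
    ∑ i ∈ Finset.range L, N.choose (i / 2) * (N - i / 2).choose (L - 1 - i) =
      walkCount N D + walkCount N (D + 1) := by
  rw [← sum_choose_mul_choose N D L (by omega)]
  refine Finset.sum_congr rfl fun i hi => ?_
  have := Finset.mem_range.1 hi
  rw [mul_comm ((D + i).choose _), Nat.choose_mul (by omega)]
  congr 1
  rw [← Nat.choose_symm (by omega)]
  congr 1
  omega

/-- Pascal's rule for the second factor; it applies because `i / 2 ≤ N` unless the first factor
vanishes. -/
theorem sum_choose_mul_choose_pascal (N r L : ℕ) :
    ∑ i ∈ Finset.range (L + 1), N.choose (i / 2) * (N + (r + 1) - i / 2).choose (L - i) =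
      ∑ i ∈ Finset.range (L + 1), N.choose (i / 2) * (N + r - i / 2).choose (L - i) +
        ∑ i ∈ Finset.range L, N.choose (i / 2) * (N + r - i / 2).choose (L - 1 - i) := by
  rw [Finset.sum_range_succ, Finset.sum_range_succ (fun i =>
    N.choose (i / 2) * (N + r - i / 2).choose (L - i)), add_right_comm, ← Finset.sum_add_distrib]
  congr 1
  · refine Finset.sum_congr rfl fun i hi => ?_
    have := Finset.mem_range.1 hi
    rcases le_or_gt (i / 2) N with h | h
    · rw [show N + (r + 1) - i / 2 = N + r - i / 2 + 1 by omega,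
        show L - i = L - 1 - i + 1 by omega, Nat.choose_succ_succ]
      ring
    · rw [Nat.choose_eq_zero_of_lt h]
      simp
  · simp

/-- The case `D = -1` of `sum_choose_mul_choose_sub`. -/
theorem sum_choose_mul_choose_sub_neg (N : ℕ) :
    ∑ i ∈ Finset.range (N + 2), N.choose (i / 2) * (N - i / 2).choose (N + 1 - i) =
      walkCount N (-1) + walkCount N 0 := by
  have h := sum_choose_mul_choose_sub N 0 (N + 1) (by omega)
  rw [walkCount_neg, add_comm (walkCount N 1)]
  simp only [Nat.cast_zero, zero_add] at h
  rw [← h, Finset.sum_range_succ', Nat.choose_eq_zero_of_lt (n := N - 0 / 2) (by omega), mul_zero,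
    add_zero]
  refine Finset.sum_congr rfl fun j hj => ?_
  have hj := Finset.mem_range.1 hj
  rw [show N + 1 - (j + 1) = N - j by omega, show N + 1 - 1 - j = N - j by omega]
  rcases Nat.even_or_odd' j with ⟨a, rfl | rfl⟩
  · rw [show (2 * a + 1) / 2 = 2 * a / 2 by omega]
  · rw [show (2 * a + 1 + 1) / 2 = a + 1 by omega, show (2 * a + 1) / 2 = a by omega]
    have h1 := Nat.choose_mul (n := N) (k := 2 * a + 1) (s := a) (by omega)
    have h2 := Nat.choose_mul (n := N) (k := 2 * a + 1) (s := a + 1) (by omega)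
    have hsymm : (2 * a + 1).choose (a + 1) = (2 * a + 1).choose a := Nat.choose_symm_half a
    rw [← Nat.choose_symm (n := N - (a + 1)) (by omega), ← Nat.choose_symm (n := N - a) (by omega),
      show N - (a + 1) - (N - (2 * a + 1)) = 2 * a + 1 - (a + 1) by omega,
      show N - a - (N - (2 * a + 1)) = 2 * a + 1 - a by omega, ← h1, ← h2, hsymm]

/-! ### Cores for `s` and `s + 2 d` in terms of profiles -/

namespace StrictPartition

open IsProfile

variable {s d : ℕ} {lam : StrictPartition}

theorem isBarCore_iff_isClosed (hs : 0 < s) (hodd : Odd s) : lam.IsBarCore s ↔ lam.IsClosed s := by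
  rw [isBarCore_iff _ hs]
  obtain ⟨k, rfl⟩ := hodd
  exact ⟨fun h x hx => h x hx (by omega), fun h x hx _ => h x hx⟩

theorem IsClosed.isBarCore (hs : 0 < s) (h : lam.IsClosed s) : lam.IsBarCore s :=
  (isBarCore_iff _ hs).2 fun x hx _ => h x hx

theorem isCSYD_iff_isBarCore (hs : 0 < s) (hodd : Odd s) : lam.IsCSYD s ↔ lam.IsBarCore s := by
  rw [isCSYD_iff _ hs, and_iff_left_iff_imp]
  obtain ⟨k, rfl⟩ := hodd
  intro _ x _
  omega

theorem isBarCore_iff_profile (hs : 0 < s) (hcop : IsCoprime ((s + d : ℕ) : ℤ) d)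
    (hc : lam.IsClosed (s + d)) :
    lam.IsBarCore s ↔ ∀ i j : ℤ, j ≤ lam.profile (s + d) d i →
      d * (2 * i + 1) ≠ (s + d : ℕ) * (1 - 2 * j) → j - 1 ≤ lam.profile (s + d) d (i + 1) := by
  rw [isBarCore_iff _ hs]
  have key := fun i j => mem_maya_iff_le_profile (d := d) (by omega) hc i j
  have e : ∀ i j : ℤ, (d : ℤ) * i + (s + d : ℕ) * j - s =
      d * (i + 1) + (s + d : ℕ) * (j - 1) := by
    intro i j
    push_cast
    ring
  constructor
  · intro h i j hj hne
    rw [← key, ← e]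
    refine h _ ((key i j).2 hj) fun h2 => hne ?_
    push_cast at h2 ⊢
    linear_combination h2
  · intro h x hx hne
    obtain ⟨i, j, rfl⟩ := exists_eq_add_mul hcop x
    rw [e, key]
    refine h i j ((key i j).1 hx) fun h2 => hne ?_
    push_cast at h2 ⊢
    linear_combination h2

theorem isBarCore_add_iff_profile (hs : 0 < s) (hcop : IsCoprime ((s + d : ℕ) : ℤ) d)
    (hc : lam.IsClosed (s + d)) :
    lam.IsBarCore (s + 2 * d) ↔ ∀ i j : ℤ, j ≤ lam.profile (s + d) d (i + 1) →
      d * (2 * i + 1) ≠ (s + d : ℕ) * (1 - 2 * j) → j - 1 ≤ lam.profile (s + d) d i := by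
  rw [isBarCore_iff _ (by omega)]
  have key := fun i j => mem_maya_iff_le_profile (d := d) (by omega) hc i j
  have e : ∀ i j : ℤ, (d : ℤ) * (i + 1) + (s + d : ℕ) * j - (s + 2 * d : ℕ) =
      d * i + (s + d : ℕ) * (j - 1) := by
    intro i j
    push_cast
    ring
  constructor
  · intro h i j hj hne
    rw [← key, ← e]
    refine h _ ((key (i + 1) j).2 hj) fun h2 => hne ?_
    push_cast at h2 ⊢
    linear_combination h2
  · intro h x hx hne
    obtain ⟨i, j, rfl⟩ := exists_eq_add_mul hcop x
    obtain ⟨i, rfl⟩ : ∃ i', i = i' + 1 := ⟨i - 1, by ring⟩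
    rw [e, key]
    refine h i j ((key (i + 1) j).1 hx) fun h2 => hne ?_
    push_cast at h2 ⊢
    linear_combination h2

theorem isClosed_iff_profile (hs : 0 < s) (hcop : IsCoprime ((s + d : ℕ) : ℤ) d)
    (hc : lam.IsClosed (s + d)) :
    lam.IsClosed s ↔
      ∀ i : ℤ, lam.profile (s + d) d i - 1 ≤ lam.profile (s + d) d (i + 1) := by
  have key := fun i j => mem_maya_iff_le_profile (d := d) (by omega) hc i j
  have e : ∀ i j : ℤ, (d : ℤ) * i + (s + d : ℕ) * j - s =
      d * (i + 1) + (s + d : ℕ) * (j - 1) := by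
    intro i j
    push_cast
    ring
  constructor
  · intro h i
    rw [← key, ← e]
    exact h _ ((key i _).2 le_rfl)
  · intro h x hx
    obtain ⟨i, j, rfl⟩ := exists_eq_add_mul hcop x
    rw [e, key]
    rw [key] at hx
    have := h i
    omega

theorem isClosed_add_iff_profile (hs : 0 < s) (hcop : IsCoprime ((s + d : ℕ) : ℤ) d)
    (hc : lam.IsClosed (s + d)) :
    lam.IsClosed (s + 2 * d) ↔
      ∀ i : ℤ, lam.profile (s + d) d (i + 1) - 1 ≤ lam.profile (s + d) d i := by
  have key := fun i j => mem_maya_iff_le_profile (d := d) (by omega) hc i j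
  have e : ∀ i j : ℤ, (d : ℤ) * (i + 1) + (s + d : ℕ) * j - (s + 2 * d : ℕ) =
      d * i + (s + d : ℕ) * (j - 1) := by
    intro i j
    push_cast
    ring
  constructor
  · intro h i
    rw [← key, ← e]
    exact h _ ((key (i + 1) _).2 le_rfl)
  · intro h x hx
    obtain ⟨i, j, rfl⟩ := exists_eq_add_mul hcop x
    obtain ⟨i, rfl⟩ : ∃ i', i = i' + 1 := ⟨i - 1, by ring⟩
    rw [e, key]
    rw [key] at hx
    have := h i
    omega

end StrictPartition

namespace IsProfile

variable {n d : ℕ} {h : ℤ → ℤ}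

theorem exists_of_dvd_two_mul_add_one {i : ℤ} (hi : (n : ℤ) ∣ 2 * i + 1) :
    Odd n ∧ ∃ t : ℤ, i = (n / 2 : ℕ) + n * t := by
  obtain ⟨q, hq⟩ := hi
  have hodd : Odd ((n : ℤ) * q) := ⟨i, hq.symm⟩
  rw [Int.odd_mul] at hodd
  obtain ⟨hn, t, rfl⟩ := hodd
  obtain ⟨m, rfl⟩ : Odd n := by exact_mod_cast hn
  refine ⟨⟨m, rfl⟩, t, ?_⟩
  have e : (2 * m + 1) / 2 = m := by omega
  rw [e]
  push_cast at hq ⊢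
  linarith

theorem middle_eq (hh : IsProfile n d h) (hn : 2 ≤ n) (hodd : Odd n) (t : ℤ) :
    h ((n / 2 : ℕ) + n * t) = h (n / 2 : ℕ) - d * t ∧
      h ((n / 2 : ℕ) + n * t + 1) = -1 - d - h (n / 2 : ℕ) - d * t := by
  refine ⟨hh.add_mul_period _ _, ?_⟩
  rw [← hh.sub_eq, ← hh.add_mul_period]
  · congr 1
    obtain ⟨m, rfl⟩ := hodd
    rw [show (2 * m + 1) / 2 = m by omega]
    push_cast
    ring
  · intro hd
    have := Int.le_of_dvd (by omega) hd
    omega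

theorem forall_abs_sub_le_one_iff (hh : IsProfile n d h) (hn : 2 ≤ n) :
    (∀ i, |h (i + 1) - h i| ≤ 1) ↔
      HasUnitSteps n h ∧ (Odd n → |2 * h (n / 2 : ℕ) + 1 + d| ≤ 1) := by
  constructor
  · intro H
    refine ⟨fun i _ => H i, fun hodd => ?_⟩
    have h1 := hh.middle_eq hn hodd 0
    simp only [mul_zero, add_zero, sub_zero, true_and] at h1
    have := H (n / 2 : ℕ)
    rw [h1, abs_le] at this
    rw [abs_le]
    omega
  · rintro ⟨h1, h2⟩ i
    by_cases hi : (n : ℤ) ∣ 2 * i + 1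
    · obtain ⟨hodd, t, rfl⟩ := exists_of_dvd_two_mul_add_one hi
      have h3 := h2 hodd
      obtain ⟨h4, h5⟩ := hh.middle_eq hn hodd t
      rw [h4, h5]
      rw [abs_le] at h3 ⊢
      omega
    · exact h1 i hi

/-- One of the two inequalities behind a unit step, with the exception that a bar core allows
the part `s / 2`. In the middle the values `f` and `g` of the profile on both sides of the step
have sum `2 c`, up to periodicity, and the exception admits `f = c + 1` besides `f ≤ c`. -/
theorem forall_exception_iff {f g : ℤ → ℤ} {c : ℤ} (hcop : IsCoprime (n : ℤ) d)
    (hn : 0 < n) (hodd : Odd n) (hc : 2 * c = -1 - d)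
    (hf : ∀ t : ℤ, f ((n / 2 : ℕ) + n * t) = f (n / 2 : ℕ) - d * t)
    (hg : ∀ t : ℤ, g ((n / 2 : ℕ) + n * t) = 2 * c - f (n / 2 : ℕ) - d * t) :
    (∀ i j : ℤ, j ≤ f i → d * (2 * i + 1) ≠ n * (1 - 2 * j) → j - 1 ≤ g i) ↔
      (∀ i : ℤ, ¬ (n : ℤ) ∣ 2 * i + 1 → f i - 1 ≤ g i) ∧ f (n / 2 : ℕ) ≤ c + 1 := by
  have hmid : (2 : ℤ) * (n / 2 : ℕ) + 1 = n := by
    obtain ⟨m, rfl⟩ := hodd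
    omega
  have hexc : ∀ t j : ℤ, d * (2 * ((n / 2 : ℕ) + n * t) + 1) = n * (1 - 2 * j) ↔
      j = c + 1 - d * t := by
    intro t j
    have e : (d : ℤ) * (2 * ((n / 2 : ℕ) + n * t) + 1) = n * (d * (1 + 2 * t)) := by
      linear_combination (d : ℤ) * hmid
    rw [e, mul_right_inj' (by omega), mul_add, mul_one, mul_left_comm]
    omega
  constructor
  · intro H
    refine ⟨fun i hi => H i _ le_rfl fun he => hi ?_, ?_⟩
    · exact hcop.dvd_of_dvd_mul_left ⟨_, he⟩
    · by_contra hlt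
      have h1 := hexc 0 (f (n / 2 : ℕ))
      have h2 := hg 0
      have h3 := H (n / 2 : ℕ) _ le_rfl
      simp only [mul_zero, add_zero, sub_zero] at h1 h2
      rw [Ne, h1, h2] at h3
      have := h3 (by omega)
      omega
  · rintro ⟨H, hle⟩ i j hj hne
    by_cases hi : (n : ℤ) ∣ 2 * i + 1
    · obtain ⟨-, t, rfl⟩ := exists_of_dvd_two_mul_add_one hi
      rw [hf] at hj
      rw [Ne, hexc] at hne
      rw [hg]
      omega
    · have := H i hi
      omega

theorem hasUnitSteps_iff_forall :
    HasUnitSteps n h ↔ (∀ i : ℤ, ¬ (n : ℤ) ∣ 2 * i + 1 → h i - 1 ≤ h (i + 1)) ∧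
      ∀ i : ℤ, ¬ (n : ℤ) ∣ 2 * i + 1 → h (i + 1) - 1 ≤ h i := by
  constructor
  · intro H
    refine ⟨fun i hi => ?_, fun i hi => ?_⟩ <;>
    · have := abs_le.1 (H i hi)
      omega
  · rintro ⟨h1, h2⟩ i hi
    have := h1 i hi
    have := h2 i hi
    exact abs_le.2 (by omega)

end IsProfile

namespace StrictPartition

open IsProfile

variable {s d : ℕ} {lam : StrictPartition}

theorem isCoprime_add (hsd : Nat.Coprime s d) : IsCoprime ((s + d : ℕ) : ℤ) d := by
  rw [Nat.isCoprime_iff_coprime]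
  simpa using hsd

theorem isClosed_and_isClosed_iff (hs : 0 < s) (hd : 0 < d) (hsd : Nat.Coprime s d)
    (hc : lam.IsClosed (s + d)) :
    (lam.IsClosed s ∧ lam.IsClosed (s + 2 * d)) ↔
      HasUnitSteps (s + d) (lam.profile (s + d) d) ∧
        (Odd (s + d) → |2 * lam.profile (s + d) d ((s + d) / 2 : ℕ) + 1 + d| ≤ 1) := by
  have hcop := isCoprime_add hsd
  rw [isClosed_iff_profile hs hcop hc, isClosed_add_iff_profile hs hcop hc,
    ← (isProfile_profile (by omega) hcop hc).forall_abs_sub_le_one_iff (by omega), ← forall_and]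
  refine forall_congr' fun i => ?_
  rw [abs_le]
  omega

theorem isBarCore_and_isBarCore_iff (hs : 0 < s) (hd : 0 < d) (hsd : Nat.Coprime s d)
    (hodd : Odd (s + d)) {c : ℤ} (hcd : 2 * c = -1 - d) (hc : lam.IsClosed (s + d)) :
    (lam.IsBarCore s ∧ lam.IsBarCore (s + 2 * d)) ↔
      HasUnitSteps (s + d) (lam.profile (s + d) d) ∧
        |lam.profile (s + d) d ((s + d) / 2 : ℕ) - c| ≤ 1 := by
  have hcop := isCoprime_add hsd
  have hp := isProfile_profile (by omega) hcop hc
  have hmid := hp.middle_eq (by omega) hodd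
  have h0 := hmid 0
  simp only [mul_zero, add_zero, sub_zero, true_and] at h0
  rw [isBarCore_iff_profile hs hcop hc, isBarCore_add_iff_profile hs hcop hc,
    forall_exception_iff hcop (by omega) hodd hcd (fun t => (hmid t).1)
      (fun t => by rw [(hmid t).2, hcd]),
    forall_exception_iff (f := fun i => lam.profile (s + d) d (i + 1)) hcop (by omega) hodd hcd
      (fun t => by rw [(hmid t).2, h0])
      (fun t => by rw [(hmid t).1, h0]; omega),
    hasUnitSteps_iff_forall, abs_le, h0]
  constructor
  · rintro ⟨⟨h1, h2⟩, h3, h4⟩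
    exact ⟨⟨h1, h3⟩, by omega, by omega⟩
  · rintro ⟨⟨h1, h3⟩, h2, h4⟩
    exact ⟨⟨h1, by omega⟩, h3, by omega⟩

/-- The strict partitions `λ` such that `λλ` is an `s`-, an `(s + d)`- and an `(s + 2 d)`-core. -/
def closedSet (s d : ℕ) : Set StrictPartition :=
  {lam | lam.IsClosed s ∧ lam.IsClosed (s + d) ∧ lam.IsClosed (s + 2 * d)}

theorem closedSet_eq_of_odd (hs : 0 < s) (hd : 0 < d) (hsd : Nat.Coprime s d) {c : ℤ}
    (hcd : 2 * c = -1 - d) :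
    closedSet s d = {lam ∈ unitStepCores (s + d) d |
      lam.profile (s + d) d ((s + d) / 2 : ℕ) = c} := by
  ext lam
  rw [closedSet, Set.mem_ofPred_eq, and_left_comm, Set.mem_sep_iff, unitStepCores,
    Set.mem_ofPred_eq, and_assoc]
  refine and_congr_right fun hc => ?_
  rw [isClosed_and_isClosed_iff hs hd hsd hc]
  refine and_congr_right fun _ => ?_
  rw [abs_le]
  constructor
  · intro h
    rcases Nat.even_or_odd' (s + d) with ⟨m, hm | hm⟩
    · have hp := isProfile_profile (by omega) (isCoprime_add hsd) hc
      have := hp.two_mul_half (by omega) hm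
      rw [show (s + d) / 2 = m by omega]
      omega
    · have := h ⟨m, hm⟩
      omega
  · intro h _
    omega

theorem encard_closedSet_of_odd (hs : 0 < s) (hsd : Nat.Coprime s d) {D : ℕ}
    (hD : d = 2 * D + 1) :
    (closedSet s d).encard =
      (walkCount ((s + d) / 2 - 1) D + walkCount ((s + d) / 2 - 1) (D + 1) : ℕ) := by
  have hcd : 2 * (-(D + 1) : ℤ) = -1 - d := by omega
  rw [closedSet_eq_of_odd hs (by omega) hsd hcd,
    encard_profile_half_eq (by omega) (isCoprime_add hsd) _ (fun _ => hcd), walkCount_neg,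
    show (-(D + 1) + 1 : ℤ) = -D by ring, walkCount_neg]

theorem encard_closedSet_of_even (hs : 0 < s) (hd : 0 < d) (hsd : Nat.Coprime s d) {E : ℕ}
    (hE : d = 2 * E) (hodd : Odd s) :
    (closedSet s d).encard =
      (walkCount ((s + d) / 2 - 1) (E - 1) + 2 * walkCount ((s + d) / 2 - 1) E +
        walkCount ((s + d) / 2 - 1) (E + 1) : ℕ) := by
  have hodd' : Odd (s + d) := by
    rw [hE]
    exact hodd.add_even (even_two_mul E)
  have hev : ∀ v : ℤ, Even (s + d) → 2 * v = -1 - d :=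
    fun v h => absurd hodd' (Nat.not_odd_iff_even.2 h)
  have hset : closedSet s d =
      {lam ∈ unitStepCores (s + d) d | lam.profile (s + d) d ((s + d) / 2 : ℕ) = -E} ∪
      {lam ∈ unitStepCores (s + d) d |
        lam.profile (s + d) d ((s + d) / 2 : ℕ) = -(E + 1)} := by
    ext lam
    rw [← Set.sep_or, closedSet, Set.mem_ofPred_eq, and_left_comm, Set.mem_sep_iff, unitStepCores,
      Set.mem_ofPred_eq, and_assoc]
    refine and_congr_right fun hc => ?_
    rw [isClosed_and_isClosed_iff hs hd hsd hc]
    refine and_congr_right fun _ => ?_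
    rw [abs_le, imp_iff_right hodd']
    omega
  rw [hset, Set.encard_union_eq, encard_profile_half_eq (by omega) (isCoprime_add hsd) _ (hev _),
    encard_profile_half_eq (by omega) (isCoprime_add hsd) _ (hev _), walkCount_neg, walkCount_neg,
    show (-(E + 1) + 1 : ℤ) = -E by ring, show (-E + 1 : ℤ) = -(E - 1) by ring, walkCount_neg,
    walkCount_neg]
  · norm_cast
    ring
  · rw [Set.disjoint_left]
    rintro lam ⟨-, h1⟩ ⟨-, h2⟩
    omega

theorem mem_barCores_iff : lam ∈ barCores [s, s + d, s + 2 * d] ↔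
    lam.IsBarCore s ∧ lam.IsBarCore (s + d) ∧ lam.IsBarCore (s + 2 * d) := by
  simp [barCores]

theorem mem_coreShiftedDiagrams_iff : lam ∈ coreShiftedDiagrams [s, s + d, s + 2 * d] ↔
    lam.IsCSYD s ∧ lam.IsCSYD (s + d) ∧ lam.IsCSYD (s + 2 * d) := by
  simp [coreShiftedDiagrams]

theorem encard_doubledDistinctCores (hs : 0 < s) :
    (doubledDistinctCores [s, s + d, s + 2 * d]).encard = (closedSet s d).encard := by
  rw [← doubled_injective.encard_image]
  congr 1
  ext mu
  simp only [doubledDistinctCores, closedSet, List.mem_cons, List.not_mem_nil, or_false,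
    forall_eq_or_imp, forall_eq, Set.mem_ofPred_eq, Set.mem_image]
  constructor
  · rintro ⟨⟨lam, rfl⟩, h⟩
    rw [isCore_doubled_iff _ hs, isCore_doubled_iff _ (by omega),
      isCore_doubled_iff _ (by omega)] at h
    exact ⟨lam, h, rfl⟩
  · rintro ⟨lam, h, rfl⟩
    refine ⟨⟨lam, rfl⟩, ?_⟩
    rw [isCore_doubled_iff _ hs, isCore_doubled_iff _ (by omega), isCore_doubled_iff _ (by omega)]
    exact h

theorem barCores_eq_closedSet (hs : 0 < s) (hodd : Odd s) (hd : Even d) :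
    barCores [s, s + d, s + 2 * d] = closedSet s d := by
  ext lam
  rw [mem_barCores_iff, isBarCore_iff_isClosed hs hodd,
    isBarCore_iff_isClosed (by omega) (hodd.add_even hd),
    isBarCore_iff_isClosed (by omega) (hodd.add_even (even_two_mul d))]
  rfl

theorem coreShiftedDiagrams_subset (hs : 0 < s) :
    coreShiftedDiagrams [s, s + d, s + 2 * d] ⊆ barCores [s, s + d, s + 2 * d] := by
  intro lam h
  rw [mem_coreShiftedDiagrams_iff] at h
  exact mem_barCores_iff.2 ⟨((isCSYD_iff _ hs).1 h.1).1, ((isCSYD_iff _ (by omega)).1 h.2.1).1,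
    ((isCSYD_iff _ (by omega)).1 h.2.2).1⟩

theorem closedSet_subset_barCores (hs : 0 < s) :
    closedSet s d ⊆ barCores [s, s + d, s + 2 * d] := fun _ h =>
  mem_barCores_iff.2 ⟨h.1.isBarCore hs, h.2.1.isBarCore (by omega), h.2.2.isBarCore (by omega)⟩

end StrictPartition

/-! ### Bar cores and core shifted Young diagrams for even `s` -/

namespace StrictPartition

open IsProfile

variable {s d : ℕ} {lam : StrictPartition}

theorem barCores_eq_of_odd_add (hs : 0 < s) (hd : 0 < d) (hsd : Nat.Coprime s d)
    (hodd : Odd (s + d)) {c : ℤ} (hcd : 2 * c = -1 - d) :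
    barCores [s, s + d, s + 2 * d] = {lam ∈ unitStepCores (s + d) d |
      |lam.profile (s + d) d ((s + d) / 2 : ℕ) - c| ≤ 1} := by
  ext lam
  rw [mem_barCores_iff, isBarCore_iff_isClosed (by omega) hodd, and_left_comm, Set.mem_sep_iff,
    unitStepCores, Set.mem_ofPred_eq, and_assoc]
  exact and_congr_right fun hc => isBarCore_and_isBarCore_iff hs hd hsd hodd hcd hc

theorem encard_barCores_of_odd_add (hs : 0 < s) (hsd : Nat.Coprime s d) (hodd : Odd (s + d))
    {D : ℕ} (hD : d = 2 * D + 1) :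
    (barCores [s, s + d, s + 2 * d]).encard =
      (walkCount ((s + d) / 2) D + walkCount ((s + d) / 2) (D + 1) : ℕ) := by
  have hcd : 2 * (-(D + 1) : ℤ) = -1 - d := by omega
  have hev : ∀ v : ℤ, Even (s + d) → 2 * v = -1 - d :=
    fun v h => absurd hodd (Nat.not_odd_iff_even.2 h)
  have hcop := isCoprime_add hsd
  obtain ⟨N, hN⟩ : ∃ N, (s + d) / 2 = N + 1 := ⟨(s + d) / 2 - 1, by omega⟩
  rw [barCores_eq_of_odd_add hs (by omega) hsd hodd hcd, encard_sep_abs_sub_le_one,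
    encard_profile_half_eq (by omega) hcop _ (hev _),
    encard_profile_half_eq (by omega) hcop _ (hev _),
    encard_profile_half_eq (by omega) hcop _ (hev _), hN, Nat.add_sub_cancel,
    ← walkCount_neg _ (D : ℤ), ← walkCount_neg _ (D + 1 : ℤ), walkCount, walkCount,
    show (-(D : ℤ) - 1) = -(D + 1) by ring, sub_add_cancel,
    show -((D : ℤ) + 1) + 1 = -D by ring]
  norm_cast
  ring

/-- The numbers `3 s / 2` and `3 (s + 2 d) / 2` have the coordinates `(m - 1, c + 2)` and
`(m + 2, c + 2)`, where `2 m + 1 = s + d` and `2 c = -1 - d`. -/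
theorem coreShiftedDiagrams_eq_of_even (hs : 0 < s) (hsd : Nat.Coprime s d)
    (hodd : Odd (s + d)) {c : ℤ} (hcd : 2 * c = -1 - d) (hn : 4 ≤ s + d) :
    coreShiftedDiagrams [s, s + d, s + 2 * d] = {lam ∈ barCores [s, s + d, s + 2 * d] |
      |lam.profile (s + d) d ((s + d) / 2 - 1 : ℕ) - c| ≤ 1} := by
  have hcop := isCoprime_add hsd
  have hmid : 2 * ((s + d) / 2 - 1 : ℕ) + 3 = ((s + d : ℕ) : ℤ) := by
    obtain ⟨m, hm⟩ := hodd
    omega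
  have hiff : ∀ lam : StrictPartition, lam.IsClosed (s + d) →
      (((∀ x ∈ lam.maya, 2 * x ≠ 3 * s) ∧ ∀ x ∈ lam.maya, 2 * x ≠ 3 * (s + 2 * d : ℕ)) ↔
        |lam.profile (s + d) d ((s + d) / 2 - 1 : ℕ) - c| ≤ 1) := by
    intro lam hc
    have key := fun i j => mem_maya_iff_le_profile (d := d) (by omega) hc i j
    have hp := isProfile_profile (by omega) hcop hc
    generalize hk : ((s + d) / 2 - 1 : ℕ) = k at *
    have hhalf : lam.profile (s + d) d ((s + d : ℕ) - k) =
        -1 - d - lam.profile (s + d) d k := by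
      refine hp.sub_eq fun hd => ?_
      have := Int.le_of_dvd (by omega) hd
      omega
    have e1 : 2 * ((d : ℤ) * k + (s + d : ℕ) * (c + 2)) = 3 * s := by
      rw [← hmid]
      push_cast at hmid ⊢
      linear_combination (2 * k + 3 : ℤ) * hcd + 3 * hmid
    have e2 : 2 * ((d : ℤ) * ((s + d : ℕ) - k) + (s + d : ℕ) * (c + 2)) =
        3 * (s + 2 * d : ℕ) := by
      push_cast at hmid e1 ⊢
      linear_combination e1 - 2 * d * hmid
    have h1 : (∀ x ∈ lam.maya, 2 * x ≠ 3 * s) ↔ ¬ c + 2 ≤ lam.profile (s + d) d k := by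
      rw [← key]
      refine ⟨fun h hm => h _ hm e1, fun h x hx hx' => h ?_⟩
      rwa [show (d : ℤ) * k + (s + d : ℕ) * (c + 2) = x by omega]
    have h2 : (∀ x ∈ lam.maya, 2 * x ≠ 3 * (s + 2 * d : ℕ)) ↔
        ¬ c + 2 ≤ lam.profile (s + d) d ((s + d : ℕ) - k) := by
      rw [← key]
      refine ⟨fun h hm => h _ hm e2, fun h x hx hx' => h ?_⟩
      rwa [show (d : ℤ) * ((s + d : ℕ) - k) + (s + d : ℕ) * (c + 2) = x by omega]
    rw [h1, h2, hhalf, abs_le]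
    omega
  ext lam
  rw [Set.mem_sep_iff, mem_barCores_iff, mem_coreShiftedDiagrams_iff, isCSYD_iff _ hs,
    isCSYD_iff_isBarCore (by omega) hodd, isCSYD_iff _ (show 0 < s + 2 * d by omega)]
  have := fun h : lam.IsBarCore (s + d) => hiff lam ((isBarCore_iff_isClosed (by omega) hodd).1 h)
  tauto

theorem encard_coreShiftedDiagrams_of_even (hs : 0 < s) (hsd : Nat.Coprime s d)
    (hodd : Odd (s + d)) {D N : ℕ} (hD : d = 2 * D + 1) (hN : (s + d) / 2 = N + 2) :
    (coreShiftedDiagrams [s, s + d, s + 2 * d]).encard =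
      ((walkCount (N + 1) D + walkCount (N + 1) (D + 1)) +
        ((walkCount N (D - 1) + walkCount N D) + 2 * (walkCount N D + walkCount N (D + 1)) +
          (walkCount N (D + 1) + walkCount N (D + 2))) : ℕ) := by
  obtain ⟨c, hc⟩ : ∃ c : ℤ, c = -(D + 1) := ⟨_, rfl⟩
  have hcd : 2 * c = -1 - d := by omega
  have hev : ∀ v : ℤ, Even (s + d) → 2 * v = -1 - d :=
    fun v h => absurd hodd (Nat.not_odd_iff_even.2 h)
  have hcop := isCoprime_add hsd
  have hpred : ∀ v, {lam ∈ {lam ∈ unitStepCores (s + d) d |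
      |lam.profile (s + d) d ((s + d) / 2 - 1 : ℕ) - c| ≤ 1} |
        lam.profile (s + d) d ((s + d) / 2 : ℕ) = v}.encard =
      {lam ∈ unitStepCores (s + d) d | lam.profile (s + d) d ((s + d) / 2 : ℕ) = v ∧
        lam.profile (s + d) d ((s + d) / 2 - 1 : ℕ) = c - 1}.encard +
      {lam ∈ unitStepCores (s + d) d | lam.profile (s + d) d ((s + d) / 2 : ℕ) = v ∧
        lam.profile (s + d) d ((s + d) / 2 - 1 : ℕ) = c}.encard +
      {lam ∈ unitStepCores (s + d) d | lam.profile (s + d) d ((s + d) / 2 : ℕ) = v ∧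
        lam.profile (s + d) d ((s + d) / 2 - 1 : ℕ) = c + 1}.encard := by
    intro v
    have := encard_sep_abs_sub_le_one {lam ∈ unitStepCores (s + d) d |
      lam.profile (s + d) d ((s + d) / 2 : ℕ) = v}
      (fun lam => lam.profile (s + d) d ((s + d) / 2 - 1 : ℕ)) c
    simp only [Set.mem_sep_iff, and_assoc] at this
    rw [← this]
    congr 1
    ext lam
    simp only [Set.mem_sep_iff, and_assoc]
    tauto
  have hempty : ∀ u v : ℤ, ¬ |v - u| ≤ 1 →
      {lam ∈ unitStepCores (s + d) d | lam.profile (s + d) d ((s + d) / 2 : ℕ) = v ∧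
        lam.profile (s + d) d ((s + d) / 2 - 1 : ℕ) = u} = ∅ := by
    intro u v huv
    refine Set.eq_empty_of_forall_notMem ?_
    rintro lam ⟨⟨-, hst⟩, rfl, rfl⟩
    apply huv
    have := hst ((s + d) / 2 - 1 : ℕ) (fun hd => by
      have := Int.le_of_dvd (by omega) hd
      omega)
    rwa [show (((s + d) / 2 - 1 : ℕ) : ℤ) + 1 = ((s + d) / 2 : ℕ) by omega] at this
  have hset : coreShiftedDiagrams [s, s + d, s + 2 * d] =
      {lam ∈ {lam ∈ unitStepCores (s + d) d |
        |lam.profile (s + d) d ((s + d) / 2 - 1 : ℕ) - c| ≤ 1} |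
          |lam.profile (s + d) d ((s + d) / 2 : ℕ) - c| ≤ 1} := by
    rw [coreShiftedDiagrams_eq_of_even hs hsd hodd hcd (by omega),
      barCores_eq_of_odd_add hs (by omega) hsd hodd hcd]
    exact Set.ext fun lam => and_right_comm
  have hval := fun u v huv =>
    encard_profile_pred_half_eq (n := s + d) (by omega) hcop u v (hev v) huv
  rw [hset, encard_sep_abs_sub_le_one, hpred, hpred, hpred, hempty (c + 1) (c - 1) (by
    rw [abs_le]
    omega), hempty (c - 1) (c + 1) (by
    rw [abs_le]
    omega), hval _ _ (by simp), hval _ _ (by simp), hval _ _ (by simp), hval _ _ (by simp),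
    hval _ _ (by simp), hval _ _ (by simp), hval _ _ (by simp), hN]
  have e1 : walkCount N (c + 1 + 1) = walkCount N (D - 1) := by
    rw [← walkCount_neg]
    congr 1
    omega
  have e2 : walkCount N (c + 1) = walkCount N D := by
    rw [← walkCount_neg]
    congr 1
    omega
  have e3 : walkCount N c = walkCount N (D + 1) := by
    rw [← walkCount_neg]
    congr 1
    omega
  have e4 : walkCount N (c - 1) = walkCount N (D + 2) := by
    rw [← walkCount_neg]
    congr 1
    omega
  rw [Nat.add_sub_cancel, sub_add_cancel, e1, e2, e3, e4, walkCount, walkCount,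
    add_sub_cancel_right, add_assoc (D : ℤ) 1 1, one_add_one_eq_two, Set.encard_empty]
  norm_cast
  ring

/-- For `m > 0`, the map `f` removes the part `m` if it is there, and inserts it otherwise. -/
theorem exists_toggle {m : ℤ} (hm : m ≠ 0) :
    ∃ f : StrictPartition → StrictPartition,
      ∀ lam x, x ∈ (f lam).maya ↔ if x = m ∨ x = -m then x ∉ lam.maya else x ∈ lam.maya := by
  have h : ∀ lam : StrictPartition, ∃ mu : StrictPartition, mu.maya =
      {x | if x = m ∨ x = -m then x ∉ lam.maya else x ∈ lam.maya} := by
    intro lam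
    obtain ⟨B, hB⟩ := lam.exists_forall_maya_le
    refine StrictPartition.exists_maya_eq _ ?_ ?_ (max B |m|) ?_
    · rw [Set.mem_ofPred_eq, if_neg (by omega)]
      exact lam.zero_notMem_maya
    · intro x hx
      have := lam.neg_mem_maya hx
      simp only [Set.mem_ofPred_eq]
      by_cases hxm : x = m ∨ x = -m
      · rw [if_pos hxm, if_pos (by omega), this]
      · rw [if_neg hxm, if_neg (by omega), this]
    · intro x hx
      rw [Set.mem_ofPred_eq] at hx
      split_ifs at hx with hxm
      · refine le_max_of_le_right ?_
        rcases hxm with rfl | rfl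
        · exact le_abs_self x
        · exact neg_le_abs m
      · exact le_max_of_le_left (hB x hx)
  choose f hf using h
  exact ⟨f, fun lam x => by rw [hf, Set.mem_ofPred_eq]⟩

end StrictPartition

/-! ### Bar cores for odd `s` and odd `d` -/

namespace StrictPartition

open IsProfile

variable {s d : ℕ} {lam : StrictPartition}

/-- For `m = (s + d) / 2`, the part `3 m` would force both `m - d` and `d - m` into the Maya
diagram. -/
theorem three_mul_notMem_maya (hs : 0 < s) (hodd : Odd s) (hd : 0 < d) {m : ℤ}
    (hm : ((s + d : ℕ) : ℤ) = 2 * m)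
    (h : lam ∈ barCores [s, s + d, s + 2 * d]) : 3 * m ∉ lam.maya := by
  rw [mem_barCores_iff, isBarCore_iff_isClosed hs hodd,
    isBarCore_iff_isClosed (by omega) (hodd.add_even (even_two_mul d)),
    isBarCore_iff _ (by omega)] at h
  obtain ⟨h1, h2, h3⟩ := h
  intro hx
  have e1 := h2 _ (h1 _ hx) (by omega)
  have e2 := h3 _ hx
  rw [show 3 * m - s - (s + d : ℕ) = -(m - d) by omega] at e1
  rw [show 3 * m - (s + 2 * d : ℕ) = m - d by omega] at e2
  have hne : m - d ≠ 0 := fun h0 => lam.zero_notMem_maya (h0 ▸ e2)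
  exact (lam.neg_mem_maya hne).1 e1 e2

theorem coreShiftedDiagrams_eq_barCores_of_odd (hs : 0 < s) (hodd : Odd s) (hd : 0 < d) :
    coreShiftedDiagrams [s, s + d, s + 2 * d] = barCores [s, s + d, s + 2 * d] := by
  refine (coreShiftedDiagrams_subset hs).antisymm fun lam h => ?_
  have h' := h
  rw [mem_barCores_iff] at h'
  rw [mem_coreShiftedDiagrams_iff, isCSYD_iff_isBarCore hs hodd,
    isCSYD_iff_isBarCore (by omega) (hodd.add_even (even_two_mul d)), isCSYD_iff _ (by omega)]
  refine ⟨h'.1, ⟨h'.2.1, fun x hx hx' => ?_⟩, h'.2.2⟩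
  rcases Nat.even_or_odd' (s + d) with ⟨m, hm | hm⟩
  · have := three_mul_notMem_maya hs hodd hd (m := m) (by omega) h
    rw [show (3 * m : ℤ) = x by omega] at this
    exact this hx
  · omega

theorem barCores_sep_half_notMem (hs : 0 < s) (hodd : Odd s) {m : ℤ} (hm0 : m ≠ 0)
    (hm : ((s + d : ℕ) : ℤ) = 2 * m) :
    {lam ∈ barCores [s, s + d, s + 2 * d] | m ∉ lam.maya} = closedSet s d := by
  ext lam
  rw [Set.mem_sep_iff, mem_barCores_iff, isBarCore_iff_isClosed hs hodd,
    isBarCore_iff_isClosed (by omega) (hodd.add_even (even_two_mul d)),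
    isBarCore_iff _ (by omega)]
  constructor
  · rintro ⟨⟨h1, h2, h3⟩, h4⟩
    refine ⟨h1, fun x hx => h2 x hx fun hx' => h4 ?_, h3⟩
    rwa [show m = x by omega]
  · rintro ⟨h1, h2, h3⟩
    refine ⟨⟨h1, fun x hx _ => h2 x hx, h3⟩, fun hx => ?_⟩
    have := h2 _ hx
    rw [hm, show m - 2 * m = -m by ring, neg_mem_maya _ hm0] at this
    exact this hx

/-- Removing the part `m = (s + d) / 2` of `λ` leaves a `λ'` such that `λ'λ'` is a core and neither
`m + d` nor `m - d` lies in its Maya diagram; conversely these two conditions allow the part `m` to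
be inserted. -/
theorem encard_barCores_sep_half_mem (hs : 0 < s) (hodd : Odd s) (hd : 0 < d) (hne : s ≠ d)
    {m : ℤ} (hm : ((s + d : ℕ) : ℤ) = 2 * m) :
    {lam ∈ barCores [s, s + d, s + 2 * d] | m ∈ lam.maya}.encard =
      {lam ∈ closedSet s d | m + d ∉ lam.maya ∧ m - d ∉ lam.maya}.encard := by
  have hm0 : m ≠ 0 := by omega
  obtain ⟨f, hf⟩ := exists_toggle hm0
  have hff : ∀ lam, f (f lam) = lam := by
    intro lam
    apply maya_injective
    ext x
    rw [hf, hf]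
    split_ifs
    · exact not_not
    · rfl
  have hf1 : ∀ lam, m ∈ (f lam).maya ↔ m ∉ lam.maya := fun lam => by
    rw [hf, if_pos (Or.inl rfl)]
  have hf2 : ∀ lam, -m ∈ (f lam).maya ↔ -m ∉ lam.maya := fun lam => by
    rw [hf, if_pos (Or.inr rfl)]
  have hf3 : ∀ lam x, x ≠ m → x ≠ -m → (x ∈ (f lam).maya ↔ x ∈ lam.maya) := by
    intro lam x h1 h2
    rw [hf, if_neg (by tauto)]
  rw [← (Function.LeftInverse.injective hff).encard_image]
  congr 1
  ext mu
  constructor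
  · rintro ⟨lam, ⟨hlam, hm1⟩, rfl⟩
    have h3m := three_mul_notMem_maya hs hodd hd hm hlam
    rw [mem_barCores_iff, isBarCore_iff_isClosed hs hodd,
      isBarCore_iff_isClosed (by omega) (hodd.add_even (even_two_mul d)),
      isBarCore_iff _ (by omega)] at hlam
    obtain ⟨h1, h2, h3⟩ := hlam
    have hneg := fun x hx => (lam.neg_mem_maya (x := x) hx)
    have hm2 : -m ∉ lam.maya := fun h => (hneg m hm0).1 h hm1
    have a1 := h1 _ hm1
    rw [show m - s = -(m - d) by omega, hneg _ (by omega)] at a1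
    have a2 := h3 _ hm1
    rw [show m - (s + 2 * d : ℕ) = -(m + d) by omega, hneg _ (by omega)] at a2
    have a3 : m + s ∉ lam.maya := fun h => by
      have := h2 _ h (by omega)
      rw [show m + s - (s + d : ℕ) = m - d by omega] at this
      exact a1 this
    have a4 : m + (s + 2 * d : ℕ) ∉ lam.maya := fun h => by
      have := h2 _ h (by omega)
      rw [show m + (s + 2 * d : ℕ) - (s + d : ℕ) = m + d by omega] at this
      exact a2 this
    have hclosed : ∀ k : ℕ, 0 < k → m + k ∉ lam.maya →
        (∀ x ∈ lam.maya, x ≠ m → x - k ∈ lam.maya) → (f lam).IsClosed k := by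
      intro k hk hmk H x hx
      have hxm : x ≠ m := by
        rintro rfl
        exact (hf1 lam).1 hx hm1
      by_cases hxm' : x = -m
      · subst hxm'
        rw [hf3 _ _ (by omega) (by omega), show -m - k = -(m + k) by ring, hneg _ (by omega)]
        exact hmk
      · rw [hf3 _ _ hxm hxm'] at hx
        have := H x hx hxm
        rw [hf3 _ _ _ fun h => hm2 (h ▸ this)]
        · exact this
        · intro h
          apply hmk
          rwa [show m + k = x by omega]
    refine ⟨⟨hclosed s hs a3 fun x hx _ => h1 x hx, hclosed (s + d) (by omega) ?_ ?_,
      hclosed (s + 2 * d) (by omega) a4 fun x hx _ => h3 x hx⟩, ?_, ?_⟩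
    · rwa [hm, show m + 2 * m = 3 * m by ring]
    · exact fun x hx hxm => h2 x hx (by omega)
    · rwa [hf3 _ _ (by omega) (by omega)]
    · rwa [hf3 _ _ (by omega) (by omega)]
  · rintro ⟨⟨h1, h2, h3⟩, a1, a2⟩
    refine ⟨f mu, ⟨?_, ?_⟩, hff mu⟩
    all_goals
      have hneg := fun x hx => (mu.neg_mem_maya (x := x) hx)
      have hm1 : m ∉ mu.maya := fun h => by
        have := h2 _ h
        rw [hm, show m - 2 * m = -m by ring, hneg _ hm0] at this
        exact this h
    · have hclosed : ∀ k : ℕ, mu.IsClosed k → k - m ∉ mu.maya →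
          ∀ x ∈ (f mu).maya, x ≠ m → x - k ∈ (f mu).maya := by
        intro k H hk x hx hxm
        have hxm' : x ≠ -m := by
          rintro rfl
          rw [hf2, hneg _ hm0, not_not] at hx
          exact hm1 hx
        rw [hf3 _ _ hxm hxm'] at hx
        have := H x hx
        rw [hf3 _ _ fun h => hm1 (h ▸ this)]
        · exact this
        · intro h
          apply hk
          rwa [show k - m = x by omega]
      rw [mem_barCores_iff, isBarCore_iff_isClosed hs hodd,
        isBarCore_iff_isClosed (by omega) (hodd.add_even (even_two_mul d)),
        isBarCore_iff _ (by omega)]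
      refine ⟨fun x hx => ?_, fun x hx hxm => ?_, fun x hx => ?_⟩
      · by_cases hxm : x = m
        · rw [hf3 _ _ (by omega) (by omega), show x - s = -(m - d) by omega, hneg _ (by omega)]
          exact a2
        · refine hclosed s h1 ?_ x hx hxm
          rwa [show s - m = m - d by omega]
      · refine hclosed _ h2 ?_ x hx (by omega)
        rwa [show (s + d : ℕ) - m = m by omega]
      · by_cases hxm : x = m
        · rw [hf3 _ _ (by omega) (by omega), show x - (s + 2 * d : ℕ) = -(m + d) by omega,
            hneg _ (by omega)]
          exact a1
        · refine hclosed _ h3 ?_ x hx hxm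
          rwa [show (s + 2 * d : ℕ) - m = m + d by omega]
    · rwa [hf1]

theorem encard_barCores_of_odd_of_odd (hs : 0 < s) (hodd : Odd s) (hsd : Nat.Coprime s d)
    (hne : s ≠ d) {D N : ℕ} (hD : d = 2 * D + 1) (hN : s + d = 2 * (N + 2)) :
    (barCores [s, s + d, s + 2 * d]).encard =
      ((walkCount (N + 1) D + walkCount (N + 1) (D + 1)) +
        (walkCount N D + walkCount N (D + 1)) : ℕ) := by
  have hd : 0 < d := by omega
  have hcop := isCoprime_add hsd
  obtain ⟨c, hc⟩ : ∃ c : ℤ, c = -(D + 1) := ⟨_, rfl⟩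
  have hcd : 2 * c = -1 - d := by omega
  have hm : ((s + d : ℕ) : ℤ) = 2 * ((N + 2 : ℕ) : ℤ) := by omega
  have hhalf : (s + d) / 2 = N + 2 := by omega
  have hsplit : barCores [s, s + d, s + 2 * d] =
      {lam ∈ barCores [s, s + d, s + 2 * d] | ((N + 2 : ℕ) : ℤ) ∉ lam.maya} ∪
        {lam ∈ barCores [s, s + d, s + 2 * d] | ((N + 2 : ℕ) : ℤ) ∈ lam.maya} := by
    ext lam
    rw [← Set.sep_or, Set.mem_sep_iff]
    exact (and_iff_left (em' _)).symm
  have hdisj : Disjoint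
      {lam ∈ barCores [s, s + d, s + 2 * d] | ((N + 2 : ℕ) : ℤ) ∉ lam.maya}
      {lam ∈ barCores [s, s + d, s + 2 * d] | ((N + 2 : ℕ) : ℤ) ∈ lam.maya} := by
    rw [Set.disjoint_left]
    exact fun lam h1 h2 => h1.2 h2.2
  -- `-(m + d)` and `m - d` have the coordinates `(m - 1, c)` and `(m - 1, c + 1)`
  have hset : {lam ∈ closedSet s d | ((N + 2 : ℕ) : ℤ) + d ∉ lam.maya ∧
      ((N + 2 : ℕ) : ℤ) - d ∉ lam.maya} =
      {lam ∈ unitStepCores (s + d) d | lam.profile (s + d) d ((s + d) / 2 : ℕ) = c ∧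
        lam.profile (s + d) d ((s + d) / 2 - 1 : ℕ) = c} := by
    ext lam
    rw [closedSet_eq_of_odd hs hd hsd hcd, Set.mem_sep_iff, Set.mem_sep_iff, Set.mem_sep_iff,
      and_assoc]
    refine and_congr_right fun hU => and_congr_right fun _ => ?_
    have key := fun i j => mem_maya_iff_le_profile (d := d) (by omega) hU.1 i j
    rw [← lam.neg_mem_maya (by omega), show -(((N + 2 : ℕ) : ℤ) + d) =
      d * ((s + d) / 2 - 1 : ℕ) + (s + d : ℕ) * c by
        rw [hhalf, hm]
        push_cast
        linear_combination (N + 2 : ℤ) * (-1 : ℤ) * hcd, show ((N + 2 : ℕ) : ℤ) - d =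
      d * ((s + d) / 2 - 1 : ℕ) + (s + d : ℕ) * (c + 1) by
        rw [hhalf, hm]
        push_cast
        linear_combination (N + 2 : ℤ) * (-1 : ℤ) * hcd, key, key]
    omega
  rw [hsplit, Set.encard_union_eq hdisj, barCores_sep_half_notMem hs hodd (by omega) hm,
    encard_barCores_sep_half_mem hs hodd hd hne hm, encard_closedSet_of_odd hs hsd hD, hset,
    encard_profile_pred_half_eq (by omega) hcop _ _ (fun _ => hcd) (by simp), hhalf, hc,
    walkCount_neg, show (-(D + 1) + 1 : ℤ) = -D by ring, walkCount_neg]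
  norm_cast

/-- For `s = d = 1` the part `(s + d) / 2 = 1` is impossible, since it would be a bar length. -/
theorem encard_barCores_one_one : (barCores [1, 1 + 1, 1 + 2 * 1]).encard = 1 := by
  have hne : ∀ lam ∈ barCores [1, 1 + 1, 1 + 2 * 1], (1 : ℤ) ∉ lam.maya := by
    intro lam h h1
    rw [mem_barCores_iff, isBarCore_iff_isClosed one_pos odd_one] at h
    exact lam.zero_notMem_maya (by simpa using h.1 _ h1)
  have h := barCores_sep_half_notMem (s := 1) (d := 1) one_pos odd_one (m := 1) one_ne_zero
    (by norm_num)
  rw [Set.sep_eq_self_iff_mem_true.2 hne] at h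
  rw [h, encard_closedSet_of_odd one_pos (by norm_num) (D := 0) rfl]
  simp [walkCount]

end StrictPartition

/-! ### The counts as binomial sums -/

theorem Set.finite_and_ncard_of_encard {α : Type*} {S : Set α} {k : ℕ} (h : S.encard = k) :
    S.Finite ∧ S.ncard = k :=
  ⟨Set.finite_of_encard_eq_coe h, by rw [Set.ncard, h, ENat.toNat_natCast]⟩

theorem ring_choose_mul_choose {x y : ℤ} {N : ℕ} (r i k : ℕ) (hx : x = N) (hy : y = N + r) :
    Ring.choose x (i / 2) * Ring.choose (y - ((i / 2 : ℕ) : ℤ)) k =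
      ((N.choose (i / 2) * (N + r - i / 2).choose k : ℕ) : ℤ) := by
  subst hx hy
  rw [Ring.choose_natCast]
  rcases le_or_gt (i / 2) N with h | h
  · rw [show (N + r : ℤ) - ((i / 2 : ℕ) : ℤ) = (N + r - i / 2 : ℕ) by omega, Ring.choose_natCast]
    push_cast
    rfl
  · rw [Nat.choose_eq_zero_of_lt h]
    simp

open StrictPartition

theorem encard_closedSet_eq_sum_choose {s d : ℕ} (hd : 0 < d) (hsd : Nat.Coprime s d)
    (hodd : Odd s) (hev : Even d) :
    ∃ k : ℕ, (closedSet s d).encard = k ∧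
      (k : ℤ) = ∑ i ∈ Finset.range ((s - 1) / 2 + 1),
        Ring.choose (((s : ℤ) + d - 3) / 2) (i / 2) *
          Ring.choose (((s : ℤ) + d - 1) / 2 - ((i / 2 : ℕ) : ℤ)) ((s - 1) / 2 - i) := by
  obtain ⟨L, rfl⟩ := hodd
  obtain ⟨E, hE⟩ := even_iff_exists_two_mul.1 hev
  refine ⟨_, encard_closedSet_of_even (by omega) hd hsd hE ⟨L, rfl⟩, ?_⟩
  obtain ⟨K, rfl⟩ : ∃ K, E = K + 1 := ⟨E - 1, by omega⟩
  have hN : (2 * L + 1 + d) / 2 - 1 = L + K := by omega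
  simp only [ring_choose_mul_choose (N := L + K) 1 _ _
    (show ((2 * L + 1 : ℕ) + d - 3 : ℤ) / 2 = (L + K : ℕ) by omega)
    (show ((2 * L + 1 : ℕ) + d - 1 : ℤ) / 2 = (L + K : ℕ) + (1 : ℕ) by omega)]
  rw [← Nat.cast_sum, hN, show (2 * L + 1 - 1) / 2 = L by omega]
  have h0 := sum_choose_mul_choose_pascal (L + K) 0 L
  have h1 := sum_choose_mul_choose_sub (L + K) K (L + 1) (by ring)
  have h2 := sum_choose_mul_choose_sub (L + K) (K + 1) L (by ring)
  simp only [Nat.add_sub_cancel] at h1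
  simp only [zero_add, add_zero] at h0
  rw [h0, h1, h2]
  push_cast
  rw [add_sub_cancel_right]
  ring

theorem encard_barCores_eq_sum_choose {s d : ℕ} (hsd : Nat.Coprime s d)
    (hs : Odd s) (hd : Odd d) (hne : ¬ (s = 1 ∧ d = 1)) :
    ∃ k : ℕ, (barCores [s, s + d, s + 2 * d]).encard = k ∧
      (k : ℤ) = ∑ i ∈ Finset.range ((s - 1) / 2 + 1),
        Ring.choose (((d : ℤ) - 1) / 2 + i) (i / 2) *
          (Ring.choose (((s : ℤ) + d - 2) / 2) ((d - 1) / 2 + i) +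
            Ring.choose (((s : ℤ) + d - 4) / 2) ((d - 1) / 2 + i)) := by
  have hsd' : s ≠ d := by
    rintro rfl
    rw [Nat.coprime_self] at hsd
    exact hne ⟨hsd, hsd⟩
  have hs' := hs
  obtain ⟨L, rfl⟩ := hs
  obtain ⟨D, rfl⟩ := hd
  obtain ⟨N, hN⟩ : ∃ N, L + D = N + 1 := ⟨L + D - 1, by omega⟩
  refine ⟨_, encard_barCores_of_odd_of_odd (N := N) (by omega) hs' hsd hsd' rfl (by omega), ?_⟩
  rw [show (((2 * D + 1 : ℕ) : ℤ) - 1) / 2 = D by omega,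
    show (((2 * L + 1 : ℕ) : ℤ) + (2 * D + 1 : ℕ) - 2) / 2 = (N + 1 : ℕ) by omega,
    show (((2 * L + 1 : ℕ) : ℤ) + (2 * D + 1 : ℕ) - 4) / 2 = N by omega,
    show (2 * D + 1 - 1) / 2 = D by omega, show (2 * L + 1 - 1) / 2 = L by omega,
    ← sum_choose_mul_choose (N + 1) D (L + 1) (by omega),
    ← sum_choose_mul_choose N D (L + 1) (by omega), ← Finset.sum_add_distrib, Nat.cast_sum]
  refine Finset.sum_congr rfl fun i _ => ?_
  rw [show (D : ℤ) + i = (D + i : ℕ) by simp]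
  simp only [Ring.choose_natCast]
  push_cast
  ring

theorem encard_coreShiftedDiagrams_eq_sum_choose {s d : ℕ} (hs0 : 0 < s) (hsd : Nat.Coprime s d)
    (hs : Even s) (hd : Odd d) :
    ∃ k : ℕ, (coreShiftedDiagrams [s, s + d, s + 2 * d]).encard = k ∧
      (k : ℤ) = ∑ i ∈ Finset.range ((s - 2) / 2 + 1),
            Ring.choose (((s : ℤ) + d - 3) / 2) (i / 2) *
            Ring.choose (((s : ℤ) + d - 3) / 2 - ((i / 2 : ℕ) : ℤ)) ((s - 2) / 2 - i)
        + ∑ i ∈ Finset.range ((s - 2) / 2 + 1),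
            Ring.choose (((s : ℤ) + d - 5) / 2) (i / 2) *
            Ring.choose (((s : ℤ) + d - 1) / 2 - ((i / 2 : ℕ) : ℤ)) ((s - 2) / 2 - i) := by
  have hodd : Odd (s + d) := hs.add_odd hd
  obtain ⟨D, hD⟩ := hd
  obtain ⟨L, hL⟩ : ∃ L, s = 2 * (L + 1) := by
    obtain ⟨k, hk⟩ := hs
    exact ⟨k - 1, by omega⟩
  rcases Nat.eq_zero_or_pos (L + D) with h0 | hpos
  · -- the only case in which `(s + d - 5) / 2` is negative
    obtain rfl : s = 2 := by omega
    obtain rfl : d = 1 := by omega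
    refine ⟨2, ?_, by simp⟩
    have hB := encard_barCores_of_odd_add hs0 hsd hodd (D := 0) rfl
    have heq : coreShiftedDiagrams [2, 2 + 1, 2 + 2 * 1] = barCores [2, 2 + 1, 2 + 2 * 1] := by
      refine (coreShiftedDiagrams_subset hs0).antisymm fun lam h => ?_
      rw [mem_barCores_iff] at h
      have hc := (isBarCore_iff_isClosed (by omega) hodd).1 h.2.1
      have h3 : (3 : ℤ) ∉ lam.maya := fun h => lam.zero_notMem_maya (by simpa using hc _ h)
      have h6 : (6 : ℤ) ∉ lam.maya := fun h => h3 (by simpa using hc _ h)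
      rw [mem_coreShiftedDiagrams_iff, isCSYD_iff _ hs0, isCSYD_iff_isBarCore (by omega) hodd,
        isCSYD_iff _ (by omega)]
      refine ⟨⟨h.1, fun x hx hx' => h3 ?_⟩, h.2.1, h.2.2, fun x hx hx' => h6 ?_⟩
      · rwa [show (3 : ℤ) = x by omega]
      · rwa [show (6 : ℤ) = x by omega]
    rw [heq, hB]
    simp [walkCount]
  · obtain ⟨N, hN⟩ : ∃ N, L + D = N + 1 := ⟨L + D - 1, by omega⟩
    refine ⟨_, encard_coreShiftedDiagrams_of_even hs0 hsd hodd hD (N := N) (by omega), ?_⟩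
    simp only [ring_choose_mul_choose (N := N + 1) 0 _ _
      (show ((s : ℤ) + d - 3) / 2 = (N + 1 : ℕ) by omega)
      (show ((s : ℤ) + d - 3) / 2 = (N + 1 : ℕ) + (0 : ℕ) by omega),
      ring_choose_mul_choose (N := N) 2 _ _
      (show ((s : ℤ) + d - 5) / 2 = N by omega)
      (show ((s : ℤ) + d - 1) / 2 = N + (2 : ℕ) by omega)]
    rw [← Nat.cast_sum, ← Nat.cast_sum, ← Nat.cast_add, show (s - 2) / 2 = L by omega]
    congr 2
    · rw [← sum_choose_mul_choose_sub (N + 1) D (L + 1) (by omega)]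
      rfl
    · have p1 := sum_choose_mul_choose_pascal N 1 L
      have p2 := sum_choose_mul_choose_pascal N 0 L
      have q1 := sum_choose_mul_choose_sub N D L (by omega)
      have q2 : ∑ i ∈ Finset.range (L + 1), N.choose (i / 2) * (N - i / 2).choose (L - i) =
          walkCount N (D - 1) + walkCount N D := by
        rcases Nat.eq_zero_or_pos D with rfl | hD0
        · obtain rfl : L = N + 1 := by omega
          exact sum_choose_mul_choose_sub_neg N
        · obtain ⟨K, rfl⟩ : ∃ K, D = K + 1 := ⟨D - 1, by omega⟩
          have := sum_choose_mul_choose_sub N K (L + 1) (by omega)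
          simp only [Nat.add_sub_cancel] at this
          rw [this, Nat.cast_add, Nat.cast_one, add_sub_cancel_right]
      have q3 : ∑ i ∈ Finset.range L, N.choose (i / 2) * (N + 1 - i / 2).choose (L - 1 - i) =
          (walkCount N D + walkCount N (D + 1)) +
            (walkCount N (D + 1) + walkCount N (D + 2)) := by
        rcases Nat.eq_zero_or_pos L with rfl | hL0
        · have q4 := sum_choose_mul_choose N (D + 1) 0 (by omega)
          rw [Finset.sum_range_zero, Nat.cast_add, Nat.cast_one, add_assoc (D : ℤ) 1 1,
            one_add_one_eq_two] at q4
          rw [← q1, ← q4]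
          rfl
        · obtain ⟨M, rfl⟩ : ∃ M, L = M + 1 := ⟨L - 1, by omega⟩
          have p3 := sum_choose_mul_choose_pascal N 0 M
          have q4 := sum_choose_mul_choose_sub N (D + 1) M (by omega)
          simp only [Nat.add_sub_cancel] at q1 ⊢
          simp only [zero_add, add_zero] at p3
          rw [p3, q1, q4, Nat.cast_add, Nat.cast_one, add_assoc (D : ℤ) 1 1, one_add_one_eq_two]
      simp only [zero_add, add_zero] at p2
      simp only [one_add_one_eq_two] at p1
      rw [p1, p2, q1, q2, q3]
      ring

/-- `Ring.choose x k` is the binomial coefficient `x (x - 1) ⋯ (x - k + 1) / k!` of `x : ℤ`.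
Every subtraction in `ℕ` and, under the parity hypothesis of its part, every division below is
exact, apart from the floors `⌊i/2⌋`, `⌊(d+i)/2⌋` and those of part (d). -/
theorem theorem1p2 (s d : ℕ) (hs : 0 < s) (hd : 0 < d) (hsd : Nat.Coprime s d) :
    (barCores [s, s + d, s + 2 * d]).Finite ∧
    (coreShiftedDiagrams [s, s + d, s + 2 * d]).Finite ∧
    (doubledDistinctCores [s, s + d, s + 2 * d]).Finite ∧
    -- (a)
    (Odd s → Even d →
      (barCores [s, s + d, s + 2 * d]).ncard
        = (coreShiftedDiagrams [s, s + d, s + 2 * d]).ncard ∧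
      (coreShiftedDiagrams [s, s + d, s + 2 * d]).ncard
        = (doubledDistinctCores [s, s + d, s + 2 * d]).ncard ∧
      ((doubledDistinctCores [s, s + d, s + 2 * d]).ncard : ℤ)
        = ∑ i ∈ Finset.range ((s - 1) / 2 + 1),
            Ring.choose (((s : ℤ) + d - 3) / 2) (i / 2) *
            Ring.choose (((s : ℤ) + d - 1) / 2 - ((i / 2 : ℕ) : ℤ)) ((s - 1) / 2 - i)) ∧
    -- (b)
    (Odd s → Odd d →
      (barCores [s, s + d, s + 2 * d]).ncard
        = (coreShiftedDiagrams [s, s + d, s + 2 * d]).ncard ∧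
      (s = 1 ∧ d = 1 → (coreShiftedDiagrams [s, s + d, s + 2 * d]).ncard = 1) ∧
      (¬ (s = 1 ∧ d = 1) →
        ((coreShiftedDiagrams [s, s + d, s + 2 * d]).ncard : ℤ)
          = ∑ i ∈ Finset.range ((s - 1) / 2 + 1),
              Ring.choose (((d : ℤ) - 1) / 2 + i) (i / 2) *
              (Ring.choose (((s : ℤ) + d - 2) / 2) ((d - 1) / 2 + i) +
                Ring.choose (((s : ℤ) + d - 4) / 2) ((d - 1) / 2 + i)))) ∧
    -- (c)
    (Even s → Odd d →
      (barCores [s, s + d, s + 2 * d]).ncard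
        = ∑ i ∈ Finset.range (s / 2 + 1),
            trinomial ((s + d - 1) / 2) (i / 2) ((d + i) / 2) (s / 2 - i) ∧
      ((coreShiftedDiagrams [s, s + d, s + 2 * d]).ncard : ℤ)
        = ∑ i ∈ Finset.range ((s - 2) / 2 + 1),
            Ring.choose (((s : ℤ) + d - 3) / 2) (i / 2) *
            Ring.choose (((s : ℤ) + d - 3) / 2 - ((i / 2 : ℕ) : ℤ)) ((s - 2) / 2 - i)
        + ∑ i ∈ Finset.range ((s - 2) / 2 + 1),
            Ring.choose (((s : ℤ) + d - 5) / 2) (i / 2) *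
            Ring.choose (((s : ℤ) + d - 1) / 2 - ((i / 2 : ℕ) : ℤ)) ((s - 2) / 2 - i)) ∧
    -- (d)
    (Odd d →
      (doubledDistinctCores [s, s + d, s + 2 * d]).ncard
        = ∑ i ∈ Finset.range ((s - 1) / 2 + 1),
            trinomial ((s + d - 2) / 2) (i / 2) ((d + i) / 2) ((s - 1) / 2 - i)) := by
  have hDD := encard_doubledDistinctCores (s := s) (d := d) hs
  have hfin : (barCores [s, s + d, s + 2 * d]).Finite := by
    rcases Nat.even_or_odd s with hs' | hs' <;> rcases Nat.even_or_odd d with hd' | hd'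
    · exact absurd (Nat.dvd_gcd hs'.two_dvd hd'.two_dvd) (by rw [hsd]; decide)
    · obtain ⟨D, hD⟩ := hd'
      exact (Set.finite_and_ncard_of_encard
        (encard_barCores_of_odd_add hs hsd (hs'.add_odd ⟨D, hD⟩) hD)).1
    · obtain ⟨k, hk, -⟩ := encard_closedSet_eq_sum_choose hd hsd hs' hd'
      rw [barCores_eq_closedSet hs hs' hd']
      exact (Set.finite_and_ncard_of_encard hk).1
    · by_cases h1 : s = 1 ∧ d = 1
      · obtain ⟨rfl, rfl⟩ := h1
        exact Set.finite_of_encard_eq_coe encard_barCores_one_one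
      · obtain ⟨k, hk, -⟩ := encard_barCores_eq_sum_choose hsd hs' hd' h1
        exact (Set.finite_and_ncard_of_encard hk).1
  refine ⟨hfin, hfin.subset (coreShiftedDiagrams_subset hs), ?_, ?_, ?_, ?_, ?_⟩
  · rw [← Set.encard_ne_top_iff, hDD, Set.encard_ne_top_iff]
    exact hfin.subset (closedSet_subset_barCores hs)
  · intro hs' hd'
    have hBC := barCores_eq_closedSet hs hs' hd'
    have hCS : coreShiftedDiagrams [s, s + d, s + 2 * d] = barCores [s, s + d, s + 2 * d] := by
      ext lam
      rw [mem_barCores_iff, mem_coreShiftedDiagrams_iff, isCSYD_iff_isBarCore hs hs',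
        isCSYD_iff_isBarCore (by omega) (hs'.add_even hd'),
        isCSYD_iff_isBarCore (by omega) (hs'.add_even (even_two_mul d))]
    obtain ⟨k, hk, hk'⟩ := encard_closedSet_eq_sum_choose hd hsd hs' hd'
    rw [hCS, hBC, (Set.finite_and_ncard_of_encard hk).2,
      (Set.finite_and_ncard_of_encard (hDD.trans hk)).2]
    exact ⟨rfl, rfl, hk'⟩
  · intro hs' hd'
    rw [coreShiftedDiagrams_eq_barCores_of_odd hs hs' hd]
    refine ⟨rfl, ?_, fun h => ?_⟩
    · rintro ⟨rfl, rfl⟩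
      exact (Set.finite_and_ncard_of_encard (k := 1) encard_barCores_one_one).2
    · obtain ⟨k, hk, hk'⟩ := encard_barCores_eq_sum_choose hsd hs' hd' h
      rw [(Set.finite_and_ncard_of_encard hk).2]
      exact hk'
  · intro hs' hd'
    obtain ⟨k, hk, hk'⟩ := encard_coreShiftedDiagrams_eq_sum_choose hs hsd hs' hd'
    have hodd := hs'.add_odd hd'
    obtain ⟨D, rfl⟩ := hd'
    rw [(Set.finite_and_ncard_of_encard hk).2,
      (Set.finite_and_ncard_of_encard (encard_barCores_of_odd_add hs hsd hodd rfl)).2,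
      sum_trinomial _ D _ (by obtain ⟨r, rfl⟩ := hs'; omega),
      show (s + (2 * D + 1) - 1) / 2 = (s + (2 * D + 1)) / 2 by
        obtain ⟨r, rfl⟩ := hs'
        omega]
    exact ⟨rfl, hk'⟩
  · rintro ⟨D, rfl⟩
    rw [(Set.finite_and_ncard_of_encard (hDD.trans (encard_closedSet_of_odd hs hsd rfl))).2,
      sum_trinomial _ D _ (by omega),
      show (s + (2 * D + 1) - 2) / 2 = (s + (2 * D + 1)) / 2 - 1 by omega]
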